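/- **Theorem 4 (change of variables formula for Feynman path integrals).** *Setting.* A map $f:X\to Y$ between topological vector spaces is differentiable at $x$ with derivative $f'(x)$, a continuous linear map $X\to Y$, if $t_n^{-1}(f(x+t_nh_n)-f(x))-f'(x)h_n\to0$ for every convergent sequence $(h_n)$ in $X$ and all nonzero reals $t_n\to0$. Higher derivatives are taken with the topology of compact convergence on the spaces of continuous linear maps. Let $E$ be a real separable Hilbert space and let $S(E)$ be a complete barrelled real locally convex space consisting of infinitely differentiable functions $E\to\mathbb C$, with a topology finer than that of pointwise convergence, such that for all $h\in E$ and $\psi\in S(E)$: the operators $\psi\mapsto\psi'h$ and $\psi\mapsto\psi_h=\psi(\cdot+h)$ map $S(E)$ continuously into itself; the map $h\mapsto\psi_h$, $E\to S(E)$, is continuous and differentiable, and its derivative at $0$ is $h\mapsto\psi'(\cdot)h$. A generalized measure is a continuous real-linear functional $\nu:S(E)\to\mathbb C$; one writes $\int_E\psi(x)\,\nu(dx)=\nu(\psi)$ for $\psi\in S(E)$. It is a Lebesgue–Feynman measure (LFM) if $\nu(\psi_h)=\nu(\psi)$ for all $h\in E$, $\psi\in S(E)$. Let $I=(\alpha,\beta)$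 with $\alpha<0<\beta$, and let $F:I\times E\to E$ be twice continuously differentiable with $F(0,x)=x$ for all $x$, such that for each $t\in I$ the map $F(t,\cdot)$ is an infinitely differentiable bijection of $E$ with infinitely differentiable inverse $F^{-1}(t,\cdot)$, and such that $(t,x)\mapsto F^{-1}(t,x)$ is twice continuously differentiable. Write $F_1'$ and $F_2'$ for the partial derivatives of $F$ in $t$ and in $x$. Assume: 1. for all $t\in I$ and $x\in E$ the operator $F_2'(t,x)-1$ is of trace class, and for each $x$ the map $t\mapsto F_2'(t,x)$ is differentiable on $I$ with respect to the trace norm; $\det F_2'(t,x)$ denotes the Fredholm determinant; 2. for each $t\in I$, $\psi\mapsto\psi(F^{-1}(t,\cdot))$ is a continuous linear operator from $S(E)$ into itself, and for each $\psi\in S(E)$ the curve $t\mapsto\psi(F^{-1}(t,\cdot))$ in $S(E)$ is differentiable on $I$; 3. for each $t\in I$, the vector field $k_t$ defined by $k_t(F(t,x))=F_1'(t,x)$ multiplies $S(E)$ into the topological tensor product of $E$ and $S(E)$: for every $\psi\in S(E)$ there are $h_n\in E$ and $\varphi_n\in S(E)$ with $\sum_n\|h_n\|\,p(\varphi_n)<\infty$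 for every continuous seminorm $p$ on $S(E)$, and $\psi(x)k_t(x)=\sum_n\varphi_n(x)h_n$ for all $x\in E$, weakly in the complexification of $E$; 4. for each $t\in I$ the function $\det F_2'(t,\cdot)$ is a multiplicator of $S(E)$ (multiplication by it is a continuous linear operator from $S(E)$ into itself), and for each $\psi\in S(E)$ the functions $\psi/\det F_2'(t,\cdot)$, $t\in I$, belong to $S(E)$ and depend differentiably on $t\in I$ as elements of $S(E)$. *Conclusion.* For every Lebesgue–Feynman measure $\nu$, every $\varphi\in S(E)$ and every $t\in I$, $$\int_E\varphi(F^{-1}(t,x))\,\nu(dx)=\int_E\varphi(x)\,\det\big(F_2'(t,x)\big)\,\nu(dx).$$ -/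

import Mathlib

open Filter Topology
open scoped ENNReal ContDiff CompactConvergenceCLM

/-! ### Differentiability of maps between locally convex spaces -/

/-- `f` is differentiable at `x` with derivative `f'`: for every convergent sequence `hₙ` and every
sequence of nonzero reals `tₙ → 0`, one has `(f (x + tₙ hₙ) - f x) / tₙ - f' hₙ → 0`. -/
def HasSeqDerivAt {X Y : Type*} [AddCommGroup X] [Module ℝ X] [TopologicalSpace X]
    [AddCommGroup Y] [Module ℝ Y] [TopologicalSpace Y]
    (f : X → Y) (f' : X →L[ℝ] Y) (x : X) : Prop :=
  ∀ (h : ℕ → X) (h₀ : X) (t : ℕ → ℝ), Tendsto h atTop (𝓝 h₀) → (∀ n, t n ≠ 0) →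
    Tendsto t atTop (𝓝 0) →
    Tendsto (fun n => (t n)⁻¹ • (f (x + t n • h n) - f x) - f' (h n)) atTop (𝓝 0)

/-- `f` is differentiable at `x`. -/
def SeqDifferentiableAt {X Y : Type*} [AddCommGroup X] [Module ℝ X] [TopologicalSpace X]
    [AddCommGroup Y] [Module ℝ Y] [TopologicalSpace Y] (f : X → Y) (x : X) : Prop :=
  ∃ f' : X →L[ℝ] Y, HasSeqDerivAt f f' x

/-- `f` is twice continuously differentiable on the (open) set `U`; spaces of continuous linear
maps, in which the derivatives take their values, carry the topology of compact convergence. -/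
def TwiceContDiffOn {X Y : Type*} [NormedAddCommGroup X] [NormedSpace ℝ X]
    [NormedAddCommGroup Y] [NormedSpace ℝ Y] (f : X → Y) (U : Set X) : Prop :=
  ∃ (f' : X → (X →L_c[ℝ] Y)) (f'' : X → (X →L_c[ℝ] (X →L_c[ℝ] Y))),
    (∀ x ∈ U, HasSeqDerivAt f (f' x) x) ∧
    (∀ x ∈ U, HasSeqDerivAt f' (f'' x) x) ∧
    ContinuousOn f'' U

/-! ### Spaces of test functions and generalized measures -/

/-- A structure of space of test functions on `E`, carried by the real topological vector space
`S`: the elements of `S` are infinitely differentiable complex-valued functions on `E` (`toFun` is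
the inclusion of `S` into the functions on `E`), and `S` is compatible with directional
differentiation and with the shifts of `E`. -/
structure TestSpace (E S : Type*) [NormedAddCommGroup E] [InnerProductSpace ℝ E]
    [AddCommGroup S] [Module ℝ S] [TopologicalSpace S] where
  /-- the function on `E` that an element of `S` is -/
  toFun : S →ₗ[ℝ] (E → ℂ)
  injective : Function.Injective toFun
  smooth : ∀ φ : S, ContDiff ℝ ∞ (toFun φ)
  /-- the topology of `S` is finer than that of pointwise convergence -/
  continuous_eval : ∀ x : E, Continuous fun φ : S => toFun φ x
  /-- `φ ↦ φ' h` maps `S` continuously into itself -/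
  dirDeriv : E → S →L[ℝ] S
  dirDeriv_apply : ∀ (h : E) (φ : S) (x : E),
    toFun (dirDeriv h φ) x = fderiv ℝ (toFun φ) x h
  /-- the `h`-shift `φ ↦ φ (· + h)` maps `S` continuously into itself -/
  shift : E → S →L[ℝ] S
  shift_apply : ∀ (h : E) (φ : S) (x : E), toFun (shift h φ) x = toFun φ (x + h)
  shift_continuous : ∀ φ : S, Continuous fun h : E => shift h φ
  shift_differentiable : ∀ (φ : S) (h : E), SeqDifferentiableAt (fun h : E => shift h φ) h
  shift_deriv_zero : ∀ (φ : S) (L : E →L[ℝ] S), HasSeqDerivAt (fun h : E => shift h φ) L 0 →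
    ∀ h : E, L h = dirDeriv h φ

namespace TestSpace

variable {E S : Type*} [NormedAddCommGroup E] [InnerProductSpace ℝ E]
  [AddCommGroup S] [Module ℝ S] [TopologicalSpace S]

/-- A generalized measure `ν`, i.e. a continuous linear functional on the space of test functions,
is a Lebesgue-Feynman measure if it is translation invariant. -/
def IsLebesgueFeynman (Θ : TestSpace E S) (ν : S →L[ℝ] ℂ) : Prop :=
  ∀ (h : E) (φ : S), ν (Θ.shift h φ) = ν φ

open Classical in
/-- The integral `∫ f(x) ν(dx)`: the value of the generalized measure `ν` at the test function `f`
(and `0` if the function `f` is not a test function). -/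
noncomputable def integral (Θ : TestSpace E S) (ν : S →L[ℝ] ℂ) (f : E → ℂ) : ℂ :=
  if hf : ∃ φ : S, Θ.toFun φ = f then ν hf.choose else 0

theorem integral_toFun (Θ : TestSpace E S) (ν : S →L[ℝ] ℂ) (φ : S) :
    Θ.integral ν (Θ.toFun φ) = ν φ := by
  have hf : ∃ ψ : S, Θ.toFun ψ = Θ.toFun φ := ⟨φ, rfl⟩
  rw [integral, dif_pos hf, Θ.injective hf.choose_spec]

/-- Composition with `G : E → E` is a continuous linear operator in the space of test functions
(so that its adjoint, the image of generalized measures under `G`, is defined). -/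
def IsComposable (Θ : TestSpace E S) (G : E → E) : Prop :=
  ∃ P : S →L[ℝ] S, ∀ (φ : S) (x : E), Θ.toFun (P φ) x = Θ.toFun φ (G x)

/-- The real function `m` is a multiplicator: multiplication by `m` is a continuous linear operator
in the space of test functions (hence, by duality, in that of generalized measures). -/
def IsMultiplicator (Θ : TestSpace E S) (m : E → ℝ) : Prop :=
  ∃ M : S →L[ℝ] S, ∀ (φ : S) (x : E), Θ.toFun (M φ) x = (m x : ℂ) * Θ.toFun φ x

/-- The functions `w t`, for `t ∈ I`, are test functions, and `t ↦ w t` is a differentiable curve in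
the topological vector space of test functions. -/
def IsDifferentiableCurve (Θ : TestSpace E S) (I : Set ℝ) (w : ℝ → E → ℂ) : Prop :=
  ∃ u : ℝ → S, ∀ t ∈ I, Θ.toFun (u t) = w t ∧ SeqDifferentiableAt u t

/-- The vector field `k` multiplies test functions to `E`-valued test functions: for every test
function `ψ`, the function `ψ k` belongs to the topological tensor product of `E` and `S`, i.e.
it is the sum of a series `∑ φₙ hₙ` with `φₙ ∈ S`, `hₙ ∈ E` and `∑ ‖hₙ‖ p(φₙ) < ∞` for every
continuous seminorm `p` on `S`. Both sides take values in the complexification of `E`; they are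
compared by their inner products with the vectors `e` of `E`. -/
def IsVectorMultiplicator (Θ : TestSpace E S) (k : E → E) : Prop :=
  ∀ ψ : S, ∃ (h : ℕ → E) (φ : ℕ → S),
    (∀ p : Seminorm ℝ S, Continuous p → Summable fun n => ‖h n‖ * p (φ n)) ∧
    ∀ x e : E, HasSum (fun n => (inner ℝ (h n) e : ℂ) * Θ.toFun (φ n) x)
      ((inner ℝ (k x) e : ℂ) * Θ.toFun ψ x)

end TestSpace

/-! ### Trace norm and Fredholm determinant -/

/-- The trace norm (which for operators in a Hilbert space is the nuclear norm) of an operator `T`: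
the infimum of `∑ ‖aₙ‖ ‖bₙ‖` over all representations `T = ∑ ⟨aₙ, ·⟩ bₙ`. It is finite exactly
if `T` is of trace class. -/
noncomputable def traceNorm {E : Type*} [NormedAddCommGroup E] [InnerProductSpace ℝ E]
    (T : E →L[ℝ] E) : ℝ≥0∞ :=
  ⨅ (a : ℕ → E) (b : ℕ → E) (_ : ∀ x, HasSum (fun n => inner ℝ (a n) x • b n) (T x)),
    ∑' n, ‖a n‖ₑ * ‖b n‖ₑ

/-- `T` is a trace class operator. -/
def IsTraceClass {E : Type*} [NormedAddCommGroup E] [InnerProductSpace ℝ E]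
    (T : E →L[ℝ] E) : Prop :=
  traceNorm T < ⊤

/-- The compression `P_V A|_V` of the operator `A` to the finite-dimensional subspace `V` spanned by
the finite set `s`. -/
noncomputable def compression {E : Type*} [NormedAddCommGroup E] [InnerProductSpace ℝ E]
    (A : E →L[ℝ] E) (s : Finset E) :
    Submodule.span ℝ (s : Set E) →L[ℝ] Submodule.span ℝ (s : Set E) :=
  (Submodule.span ℝ (s : Set E)).orthogonalProjectionOnto ∘L A ∘L
    (Submodule.span ℝ (s : Set E)).subtypeL

/-- The Fredholm determinant of an operator `A` for which `A - 1` is of trace class: the limit of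
the determinants of the compressions of `A` to finite-dimensional subspaces, along the directed
family of these subspaces. -/
noncomputable def fredholmDet {E : Type*} [NormedAddCommGroup E] [InnerProductSpace ℝ E]
    (A : E →L[ℝ] E) : ℝ :=
  limUnder atTop fun s : Finset E => LinearMap.det (compression A s).toLinearMap

/-- The curve `A` in the space of operators is differentiable at `t` with respect to the trace
norm. -/
def TraceDifferentiableAt {E : Type*} [NormedAddCommGroup E] [InnerProductSpace ℝ E]
    (A : ℝ → E →L[ℝ] E) (t : ℝ) : Prop :=
  ∃ B : E →L[ℝ] E,
    Tendsto (fun s => traceNorm ((s - t)⁻¹ • (A s - A t) - B)) (𝓝[≠] t) (𝓝 0)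

/-! # The change of variables formula for Lebesgue–Feynman measures

Write `P t` for the composition with `F⁻¹(t, ·)` and `u t = φ / det F₂'(t, ·)`. The formula says
that `ν (P t (u t))` does not depend on `t`: the claim for a test function is obtained from this for
its product with `det F₂'(t, ·)`, since `P 0 = 1` and `det F₂'(0, ·) = 1`. Put `ψ = P t (u t)` and
let `k` be the velocity field at time `t`. The time derivative of `P t (u t)` has two contributions.

* The transport equation: moving `P t` while `u t` is fixed yields `-ψ' k`
  (`hasDerivAt_inverse_flow`).
* Jacobi's formula: moving `u t` yields `-ψ tr ((∂ₜ F₂') (F₂')⁻¹) = -ψ tr k'`, because the mixed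
  second derivatives of `F` coincide (`hasDerivAt_fredholmDet`, `hasDerivAt_velocity_line`).

So the derivative is `-(ψ' k + ψ tr k') = -div (ψ k)`. If `ψ k = ∑ φₙ hₙ` is the expansion in the
tensor product of `E` and the space of test functions, then `div (ψ k) = ∑ φₙ' hₙ`, with convergence
in the space of test functions (`TestSpace.IsVectorMultiplicator.exists_divergence`), and
translation invariance gives `ν (φₙ' hₙ) = 0`. Barrelledness enters through the Banach–Steinhaus
theorem: it yields the joint continuity of `(h, φ) ↦ φ' h` and the product rule for `P t (u t)`
(`hasDerivAt_apply_curve`).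

The theory of the Fredholm determinant rests on one formula. If `T = ∑ ⟨a i, ·⟩ b i` with
`∑ ‖a i‖ ‖b i‖ < ∞`, then `det (1 + T)` is the sum of the principal minors of the matrix
`⟨a i, b j⟩`. For finite sums in a finite-dimensional space this is the Weinstein–Aronszajn
identity; Hadamard's inequality bounds the minor with index set `s` by `∏ i ∈ s, ‖a i‖ ‖b i‖`, whose
sum over all finite `s` is finite, so that dominated convergence extends the formula to infinite
sums and to the limit of compressions. It also gives multiplicativity, by reduction to operators of
finite rank, and the expansion of the determinant at the identity; the two together give
Jacobi's formula. -/

/-! ### Principal minors of Gram matrices -/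

section GramMinors

variable {ι κ E : Type*} [NormedAddCommGroup E] [InnerProductSpace ℝ E]

/-- **Hadamard's inequality**, in coordinates with respect to an orthonormal basis. -/
theorem OrthonormalBasis.abs_det_inner_le [Fintype κ] [DecidableEq κ]
    (e : OrthonormalBasis κ ℝ E) (v : κ → E) :
    |(Matrix.of fun i j => inner ℝ (e i) (v j)).det| ≤ ∏ j, ‖v j‖ := by
  let σ := Fintype.equivFin κ
  have hn : Module.finrank ℝ E = Fintype.card κ := Module.finrank_eq_card_basis e.toBasis
  have : Fact (Module.finrank ℝ E = Fintype.card κ) := ⟨hn⟩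
  let e' := e.reindex σ
  have h := e'.toBasis.orientation.abs_volumeForm_apply_le (fun i => v (σ.symm i))
  rw [e'.toBasis.orientation.volumeForm_robust' e', Module.Basis.det_apply] at h
  have hdet : (e'.toBasis.toMatrix fun i => v (σ.symm i))
      = (Matrix.of fun i j => inner ℝ (e i) (v j)).submatrix σ.symm σ.symm := by
    ext i j
    simp [Module.Basis.toMatrix_apply, e', OrthonormalBasis.repr_apply_apply]
  rw [hdet, Matrix.det_submatrix_equiv_self] at h
  exact h.trans_eq (Equiv.prod_comp σ.symm fun i => ‖v i‖)

/-- A mixed Gram determinant is bounded by the product of the norms of the vectors. -/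
theorem abs_det_inner_le [Fintype κ] [DecidableEq κ] (a b : κ → E) :
    |(Matrix.of fun i j => inner ℝ (a i) (b j)).det| ≤ ∏ i, ‖a i‖ * ‖b i‖ := by
  by_cases ha : LinearIndependent ℝ a
  · -- both families are expanded in an orthonormal basis of the span of `a`
    let W := Submodule.span ℝ (Set.range a)
    have : FiniteDimensional ℝ W := FiniteDimensional.span_of_finite ℝ (Set.finite_range a)
    have hW : Module.finrank ℝ W = Fintype.card κ := finrank_span_eq_card ha
    let e : OrthonormalBasis κ ℝ W :=
      (stdOrthonormalBasis ℝ W).reindex (Fintype.equivFinOfCardEq hW.symm).symm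
    let a' : κ → W := fun i => ⟨a i, Submodule.subset_span ⟨i, rfl⟩⟩
    let b' : κ → W := fun i => W.orthogonalProjectionOnto (b i)
    have hab : (Matrix.of fun i j => inner ℝ (a i) (b j))
        = (Matrix.of fun i j => inner ℝ (e i) (a' j)).transpose
          * (Matrix.of fun i j => inner ℝ (e i) (b' j)) := by
      ext i j
      have h1 : inner ℝ (a i) (b j) = inner ℝ (a' i) (b' j) := by
        rw [Submodule.inner_orthogonalProjectionOnto_eq_of_mem_left]
      rw [Matrix.of_apply, h1, ← e.sum_inner_mul_inner, Matrix.mul_apply]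
      simp [real_inner_comm]
    rw [hab, Matrix.det_mul, Matrix.det_transpose, abs_mul, Finset.prod_mul_distrib]
    refine mul_le_mul (e.abs_det_inner_le a') ((e.abs_det_inner_le b').trans ?_) (abs_nonneg _)
      (Finset.prod_nonneg fun _ _ => norm_nonneg _)
    exact Finset.prod_le_prod (fun _ _ => norm_nonneg _)
      fun i _ => W.norm_orthogonalProjectionOnto_apply_le (b i)
  · obtain ⟨g, hg, i, hi⟩ := Fintype.not_linearIndependent_iff.mp ha
    have h0 : (Matrix.of fun i j => inner ℝ (a i) (b j)).det = 0 := by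
      refine Matrix.exists_vecMul_eq_zero_iff.mp ⟨g, fun h => hi (congrFun h i), ?_⟩
      ext j
      have := congrArg (fun v => inner ℝ v (b j)) hg
      simpa [sum_inner, real_inner_smul_left, Matrix.vecMul, dotProduct] using this
    rw [h0, abs_zero]
    exact Finset.prod_nonneg fun _ _ => by positivity

open Classical in
/-- The principal minor, with rows and columns in `s`, of the matrix of the inner products
`⟨a i, b j⟩`. -/
noncomputable def gramMinor (a b : ι → E) (s : Finset ι) : ℝ :=
  (Matrix.of fun i j : s => inner ℝ (a i) (b j)).det

theorem abs_gramMinor_le (a b : ι → E) (s : Finset ι) :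
    |gramMinor a b s| ≤ ∏ i ∈ s, ‖a i‖ * ‖b i‖ := by
  classical
  rw [gramMinor, ← Finset.prod_coe_sort]
  convert abs_det_inner_le (fun i : s => a i) (fun i : s => b i)

@[simp]
theorem gramMinor_empty (a b : ι → E) : gramMinor a b ∅ = 1 := by
  simp [gramMinor]

@[simp]
theorem gramMinor_singleton (a b : ι → E) (i : ι) : gramMinor a b {i} = inner ℝ (a i) (b i) := by
  classical
  rw [gramMinor, Matrix.det_unique]
  rfl

theorem gramMinor_map (f : κ ↪ ι) (a b : ι → E) (s : Finset κ) :
    gramMinor a b (s.map f) = gramMinor (a ∘ f) (b ∘ f) s := by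
  classical
  rw [gramMinor, gramMinor, ← Matrix.det_submatrix_equiv_self (s.equivMap f)]
  rfl

theorem gramMinor_congr {a b a' b' : ι → E} {s : Finset ι} (ha : ∀ i ∈ s, a i = a' i)
    (hb : ∀ i ∈ s, b i = b' i) : gramMinor a b s = gramMinor a' b' s := by
  rw [gramMinor, gramMinor]
  congr 1
  ext i j
  simp [ha i i.2, hb j j.2]

/-- The determinant of `1 + M` is the sum of the principal minors of `M`. -/
theorem Matrix.det_one_add_eq_sum_minors [Fintype κ] [DecidableEq κ] (M : Matrix κ κ ℝ) :
    (1 + M).det = ∑ s : Finset κ, (M.submatrix (↑) (↑) : Matrix s s ℝ).det := by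
  simp_rw [← Matrix.det_piecewise_one_eq_submatrix_det]
  rw [add_comm]
  exact (Matrix.detRowAlternating (R := ℝ) (n := κ)).map_add_univ M.row (1 : Matrix κ κ ℝ).row

theorem sum_powerset_gramMinor [DecidableEq ι] (a b : ι → E) (s : Finset ι) :
    ∑ t ∈ s.powerset, gramMinor a b t =
      (1 + Matrix.of fun i j : s => inner ℝ (a i) (b j)).det := by
  classical
  rw [Matrix.det_one_add_eq_sum_minors]
  symm
  refine Finset.sum_bij (fun (t : Finset s) _ => t.map (Function.Embedding.subtype _)) ?_ ?_ ?_ ?_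
  · intro t _
    rw [Finset.mem_powerset]
    intro i hi
    obtain ⟨j, -, rfl⟩ := Finset.mem_map.mp hi
    exact j.2
  · intro t _ u _ h
    exact Finset.map_injective _ h
  · intro t ht
    refine ⟨t.subtype (· ∈ s), Finset.mem_univ _, ?_⟩
    rw [Finset.subtype_map]
    exact Finset.filter_true_of_mem (Finset.mem_powerset.mp ht)
  · intro t _
    rw [gramMinor_map, gramMinor]
    congr!

/-- For a finite-rank perturbation of the identity the determinant is the sum of the principal
minors of the Gram matrix (the Weinstein–Aronszajn identity). -/
theorem det_one_add_sum_rankOne [FiniteDimensional ℝ E] (a b : ι → E) (s : Finset ι) :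
    (1 + ∑ i ∈ s, InnerProductSpace.rankOne ℝ (b i) (a i) : E →L[ℝ] E).det =
      ∑ t ∈ s.powerset, gramMinor a b t := by
  classical
  let e := stdOrthonormalBasis ℝ E
  let X : Matrix s (Fin (Module.finrank ℝ E)) ℝ := Matrix.of fun i k => inner ℝ (a i) (e k)
  let Y : Matrix (Fin (Module.finrank ℝ E)) s ℝ := Matrix.of fun k j => inner ℝ (e k) (b j)
  have hXY : (Matrix.of fun i j : s => inner ℝ (a i) (b j)) = X * Y := by
    ext i j
    simp [X, Y, Matrix.mul_apply, e.sum_inner_mul_inner]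
  rw [sum_powerset_gramMinor, hXY, Matrix.det_one_add_mul_comm, ContinuousLinearMap.det,
    ← LinearMap.det_toMatrix e.toBasis]
  congr 1
  ext k l
  rw [LinearMap.toMatrix_apply]
  simp only [OrthonormalBasis.coe_toBasis_repr_apply, OrthonormalBasis.coe_toBasis,
    OrthonormalBasis.repr_apply_apply]
  have h1 : inner ℝ (e k) (e l) = (1 : Matrix _ _ ℝ) k l := by
    rw [Matrix.one_apply]
    exact orthonormal_iff_ite.mp e.orthonormal k l
  simp only [ContinuousLinearMap.coe_coe, add_apply,
    one_apply_eq_self, sum_apply,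
    InnerProductSpace.rankOne_apply, inner_add_right, inner_sum, real_inner_smul_right, h1,
    Matrix.add_apply, Matrix.mul_apply, X, Y, Matrix.of_apply]
  rw [← Finset.sum_coe_sort s fun i => inner ℝ (a i) (e l) * inner ℝ (e k) (b i)]
  simp [mul_comm]

end GramMinors

/-! ### Nuclear expansions and the Fredholm determinant -/

section NuclearExpansions

variable {ι κ E : Type*} [NormedAddCommGroup E] [InnerProductSpace ℝ E]

/-- The families `a` and `b` form a nuclear expansion `T = ∑ ⟨a i, ·⟩ b i` of the operator `T`:
the series converges pointwise to `T`, and `∑ ‖a i‖ ‖b i‖ < ∞`. The index type is arbitrary, so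
that sums and products of operators have expansions over sums of index types. -/
structure IsNuclearExpansion (a b : ι → E) (T : E →L[ℝ] E) : Prop where
  summable : Summable fun i => ‖a i‖ * ‖b i‖
  hasSum : ∀ x, HasSum (fun i => inner ℝ (a i) x • b i) (T x)

namespace IsNuclearExpansion

variable {a b : ι → E} {c d : κ → E} {T R : E →L[ℝ] E}

theorem add (hT : IsNuclearExpansion a b T) (hR : IsNuclearExpansion c d R) :
    IsNuclearExpansion (Sum.elim a c) (Sum.elim b d) (T + R) where
  summable := by
    exact (HasSum.sum (f := fun i => ‖Sum.elim a c i‖ * ‖Sum.elim b d i‖)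
      hT.summable.hasSum hR.summable.hasSum).summable
  hasSum x := HasSum.sum (hT.hasSum x) (hR.hasSum x)

theorem comp_left (hT : IsNuclearExpansion a b T) (G : E →L[ℝ] E) :
    IsNuclearExpansion a (fun i => G (b i)) (G * T) where
  summable := by
    refine (hT.summable.mul_left ‖G‖).of_nonneg_of_le (fun i => by positivity) fun i => ?_
    calc ‖a i‖ * ‖G (b i)‖ ≤ ‖a i‖ * (‖G‖ * ‖b i‖) := by gcongr; exact G.le_opNorm _
      _ = ‖G‖ * (‖a i‖ * ‖b i‖) := by ring
  hasSum x := by simpa using G.hasSum (hT.hasSum x)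

theorem tsum_comp_left_le (hT : IsNuclearExpansion a b T) (G : E →L[ℝ] E) :
    ∑' i, ‖a i‖ * ‖G (b i)‖ ≤ ‖G‖ * ∑' i, ‖a i‖ * ‖b i‖ := by
  rw [← tsum_mul_left]
  refine (hT.comp_left G).summable.tsum_le_tsum (fun i => ?_) (hT.summable.mul_left _)
  calc ‖a i‖ * ‖G (b i)‖ ≤ ‖a i‖ * (‖G‖ * ‖b i‖) := by gcongr; exact G.le_opNorm _
    _ = ‖G‖ * (‖a i‖ * ‖b i‖) := by ring

theorem smul (hT : IsNuclearExpansion a b T) (r : ℝ) :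
    IsNuclearExpansion a (fun i => r • b i) (r • T) := by
  simpa using hT.comp_left (r • 1)

theorem comp_right [CompleteSpace E] (hT : IsNuclearExpansion a b T) (G : E →L[ℝ] E) :
    IsNuclearExpansion (fun i => G.adjoint (a i)) b (T * G) where
  summable := by
    refine (hT.summable.mul_left ‖G.adjoint‖).of_nonneg_of_le (fun i => by positivity) fun i => ?_
    calc ‖G.adjoint (a i)‖ * ‖b i‖ ≤ ‖G.adjoint‖ * ‖a i‖ * ‖b i‖ := by
          gcongr; exact G.adjoint.le_opNorm _
      _ = ‖G.adjoint‖ * (‖a i‖ * ‖b i‖) := by ring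
  hasSum x := by simpa [ContinuousLinearMap.adjoint_inner_left] using hT.hasSum (G x)

theorem summable_inner (hT : IsNuclearExpansion a b T) :
    Summable fun i => inner ℝ (a i) (b i) :=
  hT.summable.of_norm_bounded fun i => norm_inner_le_norm (a i) (b i)

theorem abs_tsum_inner_le (hT : IsNuclearExpansion a b T) :
    |∑' i, inner ℝ (a i) (b i)| ≤ ∑' i, ‖a i‖ * ‖b i‖ := by
  rw [← Real.norm_eq_abs]
  exact tsum_of_norm_bounded hT.summable.hasSum fun i => norm_inner_le_norm (a i) (b i)

theorem norm_apply_le (hT : IsNuclearExpansion a b T) (x : E) :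
    ‖T x‖ ≤ (∑' i, ‖a i‖ * ‖b i‖) * ‖x‖ := by
  rw [← (hT.hasSum x).tsum_eq]
  refine tsum_of_norm_bounded (hT.summable.hasSum.mul_right ‖x‖) fun i => ?_
  rw [norm_smul]
  calc ‖inner ℝ (a i) x‖ * ‖b i‖ ≤ ‖a i‖ * ‖x‖ * ‖b i‖ := by
        gcongr; exact norm_inner_le_norm _ _
    _ = _ := by ring

/-- Truncation to a finite set of indices. -/
theorem sum_rankOne [DecidableEq κ] (c d : κ → E) (s : Finset κ) :
    IsNuclearExpansion c (fun i => if i ∈ s then d i else 0)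
      (∑ i ∈ s, InnerProductSpace.rankOne ℝ (d i) (c i)) where
  summable := summable_of_ne_finset_zero (s := s) fun i hi => by simp [hi]
  hasSum x := by
    have h : (∑ i ∈ s, InnerProductSpace.rankOne ℝ (d i) (c i)) x
        = ∑ i ∈ s, inner ℝ (c i) x • (if i ∈ s then d i else 0) := by
      rw [sum_apply]
      exact Finset.sum_congr rfl fun i hi => by simp [hi]
    rw [h]
    exact hasSum_sum_of_ne_finset_zero fun i hi => by simp [hi]

theorem compress (hT : IsNuclearExpansion a b T) (V : Submodule ℝ E) [V.HasOrthogonalProjection] :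
    IsNuclearExpansion (fun i => V.orthogonalProjectionOnto (a i))
      (fun i => V.orthogonalProjectionOnto (b i))
      (V.orthogonalProjectionOnto ∘L T ∘L V.subtypeL) where
  summable := hT.summable.of_nonneg_of_le (fun i => by positivity) fun i => by
    gcongr <;> exact V.norm_orthogonalProjectionOnto_apply_le _
  hasSum x := by
    have h := V.orthogonalProjectionOnto.hasSum (hT.hasSum x)
    simp only [map_smul] at h
    simp only [Submodule.inner_orthogonalProjectionOnto_eq_of_mem_right]
    exact h

end IsNuclearExpansion

end NuclearExpansions

section GramSeries

variable {ι κ E : Type*} [NormedAddCommGroup E] [InnerProductSpace ℝ E]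

theorem summable_gramMinor {a b : ι → E} (h : Summable fun i => ‖a i‖ * ‖b i‖) :
    Summable (gramMinor a b) :=
  (summable_finsetProd_of_summable_nonneg (fun i => by positivity) h).of_norm_bounded
    (abs_gramMinor_le a b)

/-- Dominated convergence for the sum of all principal minors, if each of the approximating vectors
is eventually equal to its limit and never longer. -/
theorem tendsto_tsum_gramMinor {α : Type*} {l : Filter α} {a b : ι → E} {a' b' : α → ι → E}
    (h : Summable fun i => ‖a i‖ * ‖b i‖)
    (ha : ∀ i, ∀ᶠ x in l, a' x i = a i) (hb : ∀ i, ∀ᶠ x in l, b' x i = b i)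
    (ha' : ∀ x i, ‖a' x i‖ ≤ ‖a i‖) (hb' : ∀ x i, ‖b' x i‖ ≤ ‖b i‖) :
    Tendsto (fun x => ∑' s, gramMinor (a' x) (b' x) s) l (𝓝 (∑' s, gramMinor a b s)) := by
  refine tendsto_tsum_of_dominated_convergence
    (summable_finsetProd_of_summable_nonneg (fun i => by positivity) h) (fun s => ?_)
    (Eventually.of_forall fun x s => ?_)
  · refine tendsto_const_nhds.congr' ?_
    filter_upwards [s.eventually_all.mpr fun i _ => ha i, s.eventually_all.mpr fun i _ => hb i]
      with x h1 h2
    exact gramMinor_congr (fun i hi => (h1 i hi).symm) (fun i hi => (h2 i hi).symm)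
  · exact (abs_gramMinor_le _ _ s).trans (Finset.prod_le_prod (fun i _ => by positivity) fun i _ =>
      mul_le_mul (ha' x i) (hb' x i) (norm_nonneg _) (norm_nonneg _))

/-- In finite dimension, `det (1 + T)` is the sum of all principal minors of the Gram matrix of a
nuclear expansion of `T`. -/
theorem IsNuclearExpansion.det_one_add [FiniteDimensional ℝ E] {a b : ι → E} {T : E →L[ℝ] E}
    (hT : IsNuclearExpansion a b T) : (1 + T).det = ∑' s, gramMinor a b s := by
  have hs : Summable fun i => (InnerProductSpace.rankOne ℝ (b i) (a i) : E →L[ℝ] E) :=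
    hT.summable.of_norm_bounded fun i => by rw [InnerProductSpace.norm_rankOne, mul_comm]
  obtain ⟨T', hT'⟩ := hs
  have hTT' : T = T' := by
    ext x
    have h : HasSum (fun i => inner ℝ (a i) x • b i) (T' x) := by
      have hx : Continuous fun A : E →L[ℝ] E => A x := by fun_prop
      refine ((hx.tendsto T').comp hT').congr fun s => ?_
      simp
    exact (hT.hasSum x).unique h
  subst hTT'
  have h0 : Tendsto (fun s : Finset ι =>
      1 + ∑ i ∈ s, (InnerProductSpace.rankOne ℝ (b i) (a i) : E →L[ℝ] E)) atTop (𝓝 (1 + T)) :=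
    Tendsto.const_add 1 hT'
  have h1 := (ContinuousLinearMap.continuous_det.tendsto (1 + T)).comp h0
  have h2 := (summable_gramMinor hT.summable).hasSum.comp tendsto_finset_powerset_atTop_atTop
  refine tendsto_nhds_unique h1 (h2.congr fun s => ?_)
  exact (det_one_add_sum_rankOne a b s).symm

end GramSeries

section FredholmDeterminant

variable {ι κ E : Type*} [NormedAddCommGroup E] [InnerProductSpace ℝ E]
variable {a b : ι → E} {c d : κ → E} {T R : E →L[ℝ] E}

theorem IsNuclearExpansion.det_compression (hT : IsNuclearExpansion a b T) (s : Finset E) :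
    LinearMap.det (compression (1 + T) s).toLinearMap =
      ∑' t, gramMinor
        (fun i => ((Submodule.span ℝ (s : Set E)).orthogonalProjectionOnto (a i) : E))
        (fun i => ((Submodule.span ℝ (s : Set E)).orthogonalProjectionOnto (b i) : E)) t := by
  let V := Submodule.span ℝ (s : Set E)
  have h : compression (1 + T) s = 1 + V.orthogonalProjectionOnto ∘L T ∘L V.subtypeL := by
    ext x
    simp [compression, V]
  rw [h]
  exact (hT.compress V).det_one_add

/-- The determinants of the compressions of `1 + T` converge to the sum of the principal minors of
the Gram matrix of a nuclear expansion of `T`. -/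
theorem IsNuclearExpansion.tendsto_det_compression (hT : IsNuclearExpansion a b T) :
    Tendsto (fun s : Finset E => LinearMap.det (compression (1 + T) s).toLinearMap) atTop
      (𝓝 (∑' s, gramMinor a b s)) := by
  simp_rw [hT.det_compression]
  have key (x : E) : ∀ᶠ s : Finset E in atTop,
      ((Submodule.span ℝ (s : Set E)).orthogonalProjectionOnto x : E) = x := by
    filter_upwards [eventually_ge_atTop {x}] with s hs
    exact Submodule.starProjection_eq_self_iff.mpr
      (Submodule.subset_span (hs (Finset.mem_singleton_self x)))
  exact tendsto_tsum_gramMinor hT.summable (fun i => key _) (fun i => key _)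
    (fun s i => Submodule.norm_orthogonalProjectionOnto_apply_le _ _)
    (fun s i => Submodule.norm_orthogonalProjectionOnto_apply_le _ _)

theorem IsNuclearExpansion.fredholmDet_one_add (hT : IsNuclearExpansion a b T) :
    fredholmDet (1 + T) = ∑' s, gramMinor a b s :=
  hT.tendsto_det_compression.limUnder_eq

theorem fredholmDet_one : fredholmDet (1 : E →L[ℝ] E) = 1 := by
  have h : IsNuclearExpansion (fun i : Empty => (0 : E)) (fun _ => 0) (0 : E →L[ℝ] E) :=
    ⟨by simp [summable_empty], fun x => by simp [hasSum_empty]⟩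
  have h1 := h.fredholmDet_one_add
  rw [add_zero] at h1
  rw [h1, tsum_eq_single ∅ fun s hs => absurd (Subsingleton.elim s ∅) hs, gramMinor_empty]

theorem compression_mul (A B : E →L[ℝ] E) (s : Finset E)
    (hB : ∀ x ∈ Submodule.span ℝ (s : Set E), B x ∈ Submodule.span ℝ (s : Set E)) :
    compression (A * B) s = compression A s * compression B s := by
  ext x
  have h := Submodule.starProjection_eq_self_iff.mpr (hB x x.2)
  simp [compression, h]

theorem IsNuclearExpansion.one_add_mul_one_add (hT : IsNuclearExpansion a b T)
    (hR : IsNuclearExpansion c d R) :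
    ∃ K, (1 + T) * (1 + R) = 1 + K ∧
      IsNuclearExpansion (Sum.elim a c) (Sum.elim b fun i => (1 + T) (d i)) K :=
  ⟨T + (1 + T) * R, by noncomm_ring, hT.add (hR.comp_left (1 + T))⟩

/-- The Fredholm determinant is multiplicative. If the second factor is a finite-rank perturbation
of the identity, then it leaves all large subspaces invariant, and compressions to them are
multiplicative; the general case follows by truncation of a nuclear expansion. -/
theorem IsNuclearExpansion.fredholmDet_mul (hT : IsNuclearExpansion a b T)
    (hR : IsNuclearExpansion c d R) :
    fredholmDet ((1 + T) * (1 + R)) = fredholmDet (1 + T) * fredholmDet (1 + R) := by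
  classical
  have hfin (s : Finset κ) : ∑' t, gramMinor (Sum.elim a c)
        (Sum.elim b fun i => (1 + T) (if i ∈ s then d i else 0)) t
      = (∑' t, gramMinor a b t) * ∑' t, gramMinor c (fun i => if i ∈ s then d i else 0) t := by
    have hs := IsNuclearExpansion.sum_rankOne c d s
    obtain ⟨K, hK, hK'⟩ := hT.one_add_mul_one_add hs
    refine tendsto_nhds_unique hK'.tendsto_det_compression
      ((hT.tendsto_det_compression.mul hs.tendsto_det_compression).congr' ?_)
    filter_upwards [eventually_ge_atTop (s.image d)] with V hV
    rw [← hK, compression_mul, ← LinearMap.det_comp]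
    · rfl
    · intro x hx
      rw [add_apply, one_apply_eq_self, sum_apply]
      refine add_mem hx (sum_mem fun i hi => ?_)
      exact Submodule.smul_mem _ _ (Submodule.subset_span (hV (Finset.mem_image_of_mem d hi)))
  obtain ⟨K, hK, hK'⟩ := hT.one_add_mul_one_add hR
  rw [hK, hK'.fredholmDet_one_add, hT.fredholmDet_one_add, hR.fredholmDet_one_add]
  have hev (i : κ) : ∀ᶠ s : Finset κ in atTop, (if i ∈ s then d i else 0) = d i := by
    filter_upwards [eventually_ge_atTop {i}] with s hs
    exact if_pos (hs (Finset.mem_singleton_self i))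
  have hle (s : Finset κ) (i : κ) (G : E →L[ℝ] E) :
      ‖G (if i ∈ s then d i else 0)‖ ≤ ‖G (d i)‖ := by
    split_ifs <;> simp
  refine tendsto_nhds_unique (f := fun s : Finset κ => _) ?_
    (((tendsto_tsum_gramMinor (a' := fun _ : Finset κ => c) hR.summable
      (fun i => Eventually.of_forall fun _ => rfl) hev
      (fun s i => le_rfl) (fun s i => hle s i 1)).const_mul _).congr fun s => (hfin s).symm)
  refine tendsto_tsum_gramMinor (a' := fun _ : Finset κ => Sum.elim a c) hK'.summable
    (fun i => Eventually.of_forall fun _ => rfl) ?_ (fun s i => le_rfl) ?_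
  · rintro (i | i)
    · exact Eventually.of_forall fun _ => rfl
    · filter_upwards [hev i] with s hs
      simp only [Sum.elim_inr, hs]
  · rintro s (i | i)
    · exact le_rfl
    · exact hle s i (1 + T)

/-- The sum over the subsets of `s`, split according to the size of the subsets. -/
theorem Finset.sum_powerset_eq_add_sum_filter {M : Type*} [AddCommMonoid M]
    (f : Finset ι → M) (s : Finset ι) :
    ∑ t ∈ s.powerset, f t = f ∅ + ∑ i ∈ s, f {i} + ∑ t ∈ s.powerset with 2 ≤ t.card, f t := by
  classical
  rw [← Finset.sum_filter_not_add_sum_filter s.powerset (fun t => 2 ≤ t.card)]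
  congr 1
  have h : s.powerset.filter (fun t => ¬ 2 ≤ t.card)
      = s.powersetCard 0 ∪ s.powersetCard 1 := by
    ext t
    simp only [Finset.mem_filter, Finset.mem_powerset, Finset.mem_union, Finset.mem_powersetCard]
    constructor
    · rintro ⟨h1, h2⟩
      rcases Nat.lt_or_ge t.card 1 with h | h
      · exact Or.inl ⟨h1, by lia⟩
      · exact Or.inr ⟨h1, by lia⟩
    · rintro (⟨h1, h2⟩ | ⟨h1, h2⟩)
      · exact ⟨h1, by lia⟩
      · exact ⟨h1, by lia⟩
  rw [h, Finset.sum_union (Finset.disjoint_left.mpr fun t h0 h1 => ?_), Finset.powersetCard_zero,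
    Finset.sum_singleton, Finset.powersetCard_one, Finset.sum_map]
  · rfl
  · have h0' := (Finset.mem_powersetCard.mp h0).2
    have h1' := (Finset.mem_powersetCard.mp h1).2
    lia

/-- First-order expansion of the determinant at the identity. -/
theorem IsNuclearExpansion.abs_fredholmDet_one_add_sub_le (hT : IsNuclearExpansion a b T) :
    |fredholmDet (1 + T) - 1 - ∑' i, inner ℝ (a i) (b i)| ≤
      Real.exp (∑' i, ‖a i‖ * ‖b i‖) - 1 - ∑' i, ‖a i‖ * ‖b i‖ := by
  rw [hT.fredholmDet_one_add]
  have h1 : Tendsto (fun s : Finset ι => |∑ t ∈ s.powerset, gramMinor a b t - 1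
      - ∑ i ∈ s, inner ℝ (a i) (b i)|) atTop
      (𝓝 |∑' s, gramMinor a b s - 1 - ∑' i, inner ℝ (a i) (b i)|) :=
    ((((summable_gramMinor hT.summable).hasSum.comp
      tendsto_finset_powerset_atTop_atTop).sub_const 1).sub hT.summable_inner.hasSum).abs
  have hS : Tendsto (fun s : Finset ι => ∑ i ∈ s, ‖a i‖ * ‖b i‖) atTop
      (𝓝 (∑' i, ‖a i‖ * ‖b i‖)) := hT.summable.hasSum
  have h2 : Tendsto (fun s : Finset ι => Real.exp (∑ i ∈ s, ‖a i‖ * ‖b i‖) - 1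
      - ∑ i ∈ s, ‖a i‖ * ‖b i‖) atTop
      (𝓝 (Real.exp (∑' i, ‖a i‖ * ‖b i‖) - 1 - ∑' i, ‖a i‖ * ‖b i‖)) :=
    (((Real.continuous_exp.tendsto _).comp hS).sub_const 1).sub hS
  refine le_of_tendsto_of_tendsto' h1 h2 fun s => ?_
  have h3 : ∏ i ∈ s, (1 + ‖a i‖ * ‖b i‖) ≤ Real.exp (∑ i ∈ s, ‖a i‖ * ‖b i‖) :=
    Real.prod_one_add_le_exp_sum _ fun i => by positivity
  rw [Finset.prod_one_add, Finset.sum_powerset_eq_add_sum_filter] at h3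
  rw [Finset.sum_powerset_eq_add_sum_filter]
  simp only [gramMinor_empty, gramMinor_singleton, Finset.prod_empty, Finset.prod_singleton] at h3 ⊢
  rw [add_assoc, add_sub_cancel_left, add_sub_cancel_left]
  calc |∑ t ∈ s.powerset with 2 ≤ t.card, gramMinor a b t|
      ≤ ∑ t ∈ s.powerset with 2 ≤ t.card, ∏ i ∈ t, ‖a i‖ * ‖b i‖ :=
        (Finset.abs_sum_le_sum_abs _ _).trans (Finset.sum_le_sum fun t _ => abs_gramMinor_le a b t)
    _ ≤ _ := by linarith

end FredholmDeterminant

/-! ### The trace norm and Jacobi's formula -/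

section TraceNorm

variable {ι κ E : Type*} [NormedAddCommGroup E] [InnerProductSpace ℝ E]

theorem exists_isNuclearExpansion_of_traceNorm_lt {T : E →L[ℝ] E} {ε : ℝ}
    (h : traceNorm T < ENNReal.ofReal ε) :
    ∃ a b : ℕ → E, IsNuclearExpansion a b T ∧ ∑' n, ‖a n‖ * ‖b n‖ < ε := by
  simp only [traceNorm, iInf_lt_iff] at h
  obtain ⟨a, b, hab, h⟩ := h
  have hterm (n : ℕ) : ‖a n‖ₑ * ‖b n‖ₑ = ENNReal.ofReal (‖a n‖ * ‖b n‖) := by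
    rw [ENNReal.ofReal_mul (norm_nonneg _), ofReal_norm, ofReal_norm]
  simp only [hterm] at h
  have hs : Summable fun n => ‖a n‖ * ‖b n‖ := by
    have := ENNReal.summable_toReal (h.trans ENNReal.ofReal_lt_top).ne
    refine this.congr fun n => ENNReal.toReal_ofReal (by positivity)
  refine ⟨a, b, ⟨hs, hab⟩, ?_⟩
  rw [← ENNReal.ofReal_tsum_of_nonneg (fun n => by positivity) hs] at h
  exact (ENNReal.ofReal_lt_ofReal_iff_of_nonneg (tsum_nonneg fun n => by positivity)).mp h

theorem IsTraceClass.exists_isNuclearExpansion {T : E →L[ℝ] E} (h : IsTraceClass T) :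
    ∃ a b : ℕ → E, IsNuclearExpansion a b T := by
  obtain ⟨a, b, hab, -⟩ := exists_isNuclearExpansion_of_traceNorm_lt
    (T := T) (ε := (traceNorm T).toReal + 1) (by
      rw [ENNReal.ofReal_add ENNReal.toReal_nonneg zero_le_one, ENNReal.ofReal_toReal h.ne]
      exact ENNReal.lt_add_right h.ne (by simp))
  exact ⟨a, b, hab⟩

/-- The Fredholm determinant of an invertible operator does not vanish. -/
theorem IsTraceClass.fredholmDet_ne_zero {A G : E →L[ℝ] E} (hA : IsTraceClass (A - 1))
    (hGA : G * A = 1) : fredholmDet A ≠ 0 := by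
  obtain ⟨a, b, hab⟩ := hA.exists_isNuclearExpansion
  have hG : IsNuclearExpansion a (fun i => (-G) (b i)) (G - 1) := by
    have h : G - 1 = -G * (A - 1) := by rw [mul_sub, neg_mul, hGA]; noncomm_ring
    rw [h]
    exact hab.comp_left (-G)
  have h := hG.fredholmDet_mul hab
  rw [add_sub_cancel, add_sub_cancel, hGA, fredholmDet_one] at h
  exact right_ne_zero_of_mul (h ▸ one_ne_zero)

/-- The derivative of a trace-norm differentiable curve has a nuclear expansion. -/
theorem exists_isNuclearExpansion_of_tendsto {A : ℝ → E →L[ℝ] E} {t : ℝ} {B : E →L[ℝ] E}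
    (hA : ∀ᶠ s in 𝓝 t, IsTraceClass (A s - 1))
    (hB : Tendsto (fun s => traceNorm ((s - t)⁻¹ • (A s - A t) - B)) (𝓝[≠] t) (𝓝 0)) :
    ∃ a b : ℕ ⊕ ℕ ⊕ ℕ → E, IsNuclearExpansion a b B := by
  have h1 : ∀ᶠ s in 𝓝[≠] t, traceNorm ((s - t)⁻¹ • (A s - A t) - B) < ENNReal.ofReal 1 :=
    hB.eventually_lt_const (by simp)
  obtain ⟨s, hs, hAs⟩ := (h1.and (hA.filter_mono nhdsWithin_le_nhds)).exists
  obtain ⟨a₁, b₁, h₁, -⟩ := exists_isNuclearExpansion_of_traceNorm_lt hs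
  obtain ⟨a₂, b₂, h₂⟩ := hAs.exists_isNuclearExpansion
  obtain ⟨a₃, b₃, h₃⟩ := hA.self_of_nhds.exists_isNuclearExpansion
  have h := (h₁.smul (-1)).add ((h₂.smul (s - t)⁻¹).add (h₃.smul (-(s - t)⁻¹)))
  have hB' : (-1 : ℝ) • ((s - t)⁻¹ • (A s - A t) - B) +
      ((s - t)⁻¹ • (A s - 1) + (-(s - t)⁻¹) • (A t - 1)) = B := by
    module
  rw [hB'] at h
  exact ⟨_, _, h⟩

/-- Differentiability in the trace norm implies strong differentiability. -/
theorem hasDerivAt_apply_of_tendsto_traceNorm {A : ℝ → E →L[ℝ] E} {t : ℝ} {B : E →L[ℝ] E}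
    (hB : Tendsto (fun s => traceNorm ((s - t)⁻¹ • (A s - A t) - B)) (𝓝[≠] t) (𝓝 0)) (x : E) :
    HasDerivAt (fun s => A s x) (B x) t := by
  rw [hasDerivAt_iff_tendsto_slope, tendsto_iff_norm_sub_tendsto_zero, Metric.tendsto_nhds]
  intro ε hε
  have hε' : 0 < ε / (‖x‖ + 1) := by positivity
  filter_upwards [hB.eventually_lt_const (ENNReal.ofReal_pos.mpr hε')] with s hs
  obtain ⟨a, b, hab, hlt⟩ := exists_isNuclearExpansion_of_traceNorm_lt hs
  have h1 : slope (fun s => A s x) t s - B x = ((s - t)⁻¹ • (A s - A t) - B) x := by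
    simp [slope_def_module]
  rw [h1, dist_zero_right, norm_norm]
  have h0 : 0 ≤ ‖x‖ := norm_nonneg x
  calc _ ≤ _ := hab.norm_apply_le x
    _ ≤ ε / (‖x‖ + 1) * ‖x‖ := by gcongr
    _ < ε / (‖x‖ + 1) * (‖x‖ + 1) := by gcongr; linarith
    _ = ε := by field_simp

/-- Differentiation of the determinant at the identity, along a curve which is differentiable
in the trace norm. -/
theorem hasDerivAt_fredholmDet_one {A : ℝ → E →L[ℝ] E} {t : ℝ} {B G : E →L[ℝ] E} {a b : ι → E}
    (hA : G * A t = 1) (hab : IsNuclearExpansion a b B)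
    (hB : Tendsto (fun s => traceNorm ((s - t)⁻¹ • (A s - A t) - B)) (𝓝[≠] t) (𝓝 0)) :
    HasDerivAt (fun s => fredholmDet (G * A s)) (∑' i, inner ℝ (a i) (G (b i))) t := by
  rw [hasDerivAt_iff_isLittleO, Asymptotics.isLittleO_iff]
  intro ε hε
  -- `M` bounds the trace norms of the difference quotients of the curve `G * A s`
  set τ := ∑' i, ‖a i‖ * ‖b i‖ with hτ
  have hτ0 : 0 ≤ τ := tsum_nonneg fun i => by positivity
  set M := ‖G‖ * (τ + 1) with hM
  have hM0 : 0 ≤ M := by positivity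
  set δ := min 1 (ε / (2 * (‖G‖ + 1))) with hδ
  have hδ0 : 0 < δ := by positivity
  set η := min (1 / (M + 1)) (ε / (2 * (M ^ 2 + 1))) with hη
  have hη0 : 0 < η := by positivity
  have hev := eventually_nhdsWithin_iff.mp (hB.eventually_lt_const (ENNReal.ofReal_pos.mpr hδ0))
  filter_upwards [hev, Metric.ball_mem_nhds t hη0] with s hs hst
  rcases eq_or_ne s t with rfl | hne
  · simp
  obtain ⟨c, d, hcd, hlt⟩ := exists_isNuclearExpansion_of_traceNorm_lt (hs hne)
  set r := s - t with hr
  have hr0 : r ≠ 0 := sub_ne_zero.mpr hne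
  have hrη : |r| < η := by simpa [Real.dist_eq] using hst
  set R := r⁻¹ • (A s - A t) - B with hR
  have hK := ((hab.comp_left G).add (hcd.comp_left G)).smul r
  have hGA : G * A s = 1 + r • (G * B + G * R) := by
    have : A s = A t + r • (B + R) := by
      rw [hR, add_sub_cancel, smul_smul, mul_inv_cancel₀ hr0, one_smul, add_sub_cancel]
    rw [this, mul_add, hA, mul_smul_comm, mul_add]
  have hsum : (∑' i, inner ℝ (Sum.elim a c i)
        (r • (Sum.elim (fun i => G (b i)) (fun i => G (d i)) i))) =
      r * ((∑' i, inner ℝ (a i) (G (b i))) + ∑' i, inner ℝ (c i) (G (d i))) := by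
    simp_rw [real_inner_smul_right]
    rw [tsum_mul_left]
    congr 1
    exact (HasSum.sum (f := fun i => inner ℝ (Sum.elim a c i)
        (Sum.elim (fun i => G (b i)) (fun i => G (d i)) i))
      (hab.comp_left G).summable_inner.hasSum (hcd.comp_left G).summable_inner.hasSum).tsum_eq
  have hnorm : (∑' i, ‖Sum.elim a c i‖ *
        ‖r • (Sum.elim (fun i => G (b i)) (fun i => G (d i)) i)‖) =
      |r| * ((∑' i, ‖a i‖ * ‖G (b i)‖) + ∑' i, ‖c i‖ * ‖G (d i)‖) := by
    simp_rw [norm_smul, Real.norm_eq_abs, mul_left_comm _ |r|]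
    rw [tsum_mul_left]
    congr 1
    exact (HasSum.sum (f := fun i => ‖Sum.elim a c i‖ *
        ‖Sum.elim (fun i => G (b i)) (fun i => G (d i)) i‖)
      (hab.comp_left G).summable.hasSum (hcd.comp_left G).summable.hasSum).tsum_eq
  have hdet := hK.abs_fredholmDet_one_add_sub_le
  rw [hsum, hnorm, ← hGA] at hdet
  set σ := (∑' i, ‖a i‖ * ‖G (b i)‖) + ∑' i, ‖c i‖ * ‖G (d i)‖ with hσ
  have hGcd : ∑' i, ‖c i‖ * ‖G (d i)‖ ≤ ‖G‖ * δ :=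
    (hcd.tsum_comp_left_le G).trans (by gcongr)
  have hσ0 : 0 ≤ σ := add_nonneg (tsum_nonneg fun i => by positivity)
    (tsum_nonneg fun i => by positivity)
  have hσM : σ ≤ M := by
    have h1 : ‖G‖ * δ ≤ ‖G‖ * 1 := by gcongr; exact min_le_left _ _
    have h2 := hab.tsum_comp_left_le G
    rw [hM, mul_add]
    exact add_le_add h2 (hGcd.trans h1)
  have hrσ : |(|r| * σ)| ≤ 1 := by
    rw [abs_of_nonneg (by positivity)]
    calc |r| * σ ≤ 1 / (M + 1) * M := by
          gcongr; exact hrη.le.trans (min_le_left _ _)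
      _ ≤ 1 := by rw [one_div_mul_eq_div, div_le_one (by positivity)]; linarith
  have hexp := (le_abs_self _).trans (Real.abs_exp_sub_one_sub_id_le hrσ)
  have hquad : (|r| * σ) ^ 2 ≤ ε / 2 * |r| := by
    have h1 : |r| * M ^ 2 ≤ ε / 2 := by
      calc |r| * M ^ 2 ≤ ε / (2 * (M ^ 2 + 1)) * (M ^ 2 + 1) := by
            gcongr
            · exact hrη.le.trans (min_le_right _ _)
            · linarith
        _ = ε / 2 := by field_simp
    calc (|r| * σ) ^ 2 ≤ (|r| * M) ^ 2 := by gcongr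
      _ = (|r| * M ^ 2) * |r| := by ring
      _ ≤ ε / 2 * |r| := by gcongr
  have hlin : |r * ∑' i, inner ℝ (c i) (G (d i))| ≤ ε / 2 * |r| := by
    have h1 : ‖G‖ * δ ≤ ε / 2 := by
      calc ‖G‖ * δ ≤ (‖G‖ + 1) * (ε / (2 * (‖G‖ + 1))) := by
            gcongr
            · linarith
            · exact min_le_right _ _
        _ = ε / 2 := by field_simp
    have h2 := ((hcd.comp_left G).abs_tsum_inner_le.trans hGcd).trans h1
    rw [abs_mul, mul_comm]
    gcongr
  rw [hA, fredholmDet_one, Real.norm_eq_abs, Real.norm_eq_abs, smul_eq_mul]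
  have hsplit : fredholmDet (G * A s) - 1 - r * ∑' i, inner ℝ (a i) (G (b i))
      = (fredholmDet (G * A s) - 1 - r * ((∑' i, inner ℝ (a i) (G (b i)))
        + ∑' i, inner ℝ (c i) (G (d i)))) + r * ∑' i, inner ℝ (c i) (G (d i)) := by ring
  rw [hsplit]
  refine (abs_add_le _ _).trans ?_
  linarith

/-- **Jacobi's formula** for the Fredholm determinant: the logarithmic derivative of `det (A s)` is
the trace of `(A s)⁻¹ * A' s`. -/
theorem hasDerivAt_fredholmDet {A : ℝ → E →L[ℝ] E} {t : ℝ} {B G : E →L[ℝ] E} {a b : ι → E}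
    (hA : ∀ᶠ s in 𝓝 t, IsTraceClass (A s - 1)) (hGA : G * A t = 1) (hAG : A t * G = 1)
    (hab : IsNuclearExpansion a b B)
    (hB : Tendsto (fun s => traceNorm ((s - t)⁻¹ • (A s - A t) - B)) (𝓝[≠] t) (𝓝 0)) :
    HasDerivAt (fun s => fredholmDet (A s))
      (fredholmDet (A t) * ∑' i, inner ℝ (a i) (G (b i))) t := by
  have hone := hasDerivAt_fredholmDet_one hGA hab hB
  refine (hone.const_mul (fredholmDet (A t))).congr_of_eventuallyEq ?_
  -- `det (A s) = det (A t) * det (G * A s)`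
  filter_upwards [hA] with s hs
  obtain ⟨a₁, b₁, h₁⟩ := hA.self_of_nhds.exists_isNuclearExpansion
  obtain ⟨a₂, b₂, h₂⟩ := hs.exists_isNuclearExpansion
  have h₃ := (h₂.comp_left G).add (h₁.comp_left (-G))
  have h := h₁.fredholmDet_mul h₃
  have e : (1 : E →L[ℝ] E) + (G * (A s - 1) + -G * (A t - 1)) = G * A s := by
    rw [neg_mul, mul_sub, mul_sub, hGA]; noncomm_ring
  rw [add_sub_cancel, e, ← mul_assoc, hAG, one_mul] at h
  exact h

/-- The sum `∑ ⟨a i, b i⟩` over a nuclear expansion is the trace of the operator, computed in any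
Hilbert basis. -/
theorem hasSum_tsum_inner_mul_inner (e : HilbertBasis κ ℝ E) {a b : ι → E}
    (h : Summable fun i => ‖a i‖ * ‖b i‖) :
    HasSum (fun j => ∑' i, inner ℝ (a i) (e j) * inner ℝ (b i) (e j))
      (∑' i, inner ℝ (a i) (b i)) := by
  have hterm (i : ι) : HasSum (fun j => inner ℝ (a i) (e j) * inner ℝ (b i) (e j))
      (inner ℝ (a i) (b i)) := by
    simpa [real_inner_comm] using e.hasSum_inner_mul_inner (a i) (b i)
  have hsum : Summable fun p : ι × κ => inner ℝ (a p.1) (e p.2) * inner ℝ (b p.1) (e p.2) := by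
    refine Summable.of_norm ?_
    rw [summable_prod_of_nonneg fun _ => norm_nonneg _]
    refine ⟨fun i => (hterm i).summable.norm, h.of_nonneg_of_le
      (fun i => tsum_nonneg fun j => norm_nonneg _) fun i => ?_⟩
    refine Real.tsum_le_of_sum_le (fun j => norm_nonneg _) fun s => ?_
    have h1 : ∑ j ∈ s, ‖inner ℝ (a i) (e j) * inner ℝ (b i) (e j)‖ ≤
        √(∑ j ∈ s, |inner ℝ (a i) (e j)| ^ 2) * √(∑ j ∈ s, |inner ℝ (b i) (e j)| ^ 2) := by
      simp_rw [norm_mul, Real.norm_eq_abs]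
      exact Real.sum_mul_le_sqrt_mul_sqrt _ _ _
    have h2 (x : E) : √(∑ j ∈ s, |inner ℝ x (e j)| ^ 2) ≤ ‖x‖ := by
      refine Real.sqrt_le_iff.mpr ⟨norm_nonneg _, ?_⟩
      have := e.orthonormal.sum_inner_products_le (s := s) x
      simpa [real_inner_comm] using this
    exact h1.trans (mul_le_mul (h2 _) (h2 _) (Real.sqrt_nonneg _) (norm_nonneg _))
  have h1 : (∑' p : ι × κ, inner ℝ (a p.1) (e p.2) * inner ℝ (b p.1) (e p.2))
      = ∑' i, inner ℝ (a i) (b i) :=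
    (hsum.hasSum.prod_fiberwise hterm).tsum_eq.symm
  have hswap := (Equiv.prodComm κ ι).summable_iff.mpr hsum
  have h2 := hswap.hasSum.prod_fiberwise fun j => (hswap.prod_factor j).hasSum
  rw [← h1, ← (Equiv.prodComm κ ι).tsum_eq]
  exact h2

end TraceNorm

/-! ### Spaces of test functions -/

section LocallyConvex

variable {S : Type*} [AddCommGroup S] [Module ℝ S]

/-- The **Banach–Steinhaus theorem** in terms of seminorms. -/
theorem exists_seminorm_forall_le [TopologicalSpace S] [BarrelledSpace ℝ S] {ι : Type*}
    (T : ι → S →L[ℝ] S) (p : Seminorm ℝ S) (hp : Continuous p)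
    (h : ∀ φ, BddAbove (Set.range fun i => p (T i φ))) :
    ∃ q : Seminorm ℝ S, Continuous q ∧ ∀ i φ, p (T i φ) ≤ q φ := by
  have hbdd : BddAbove (Set.range fun i => p.comp (T i).toLinearMap) := by
    rw [Seminorm.bddAbove_range_iff]
    exact h
  refine ⟨⨆ i, p.comp (T i).toLinearMap, ?_, fun i φ => ?_⟩
  · rw [Seminorm.coe_iSup_eq hbdd]
    exact Seminorm.continuous_iSup _ (fun i => hp.comp (T i).continuous) hbdd
  · exact le_ciSup hbdd i φ

/-- In a complete locally convex space, absolutely convergent series converge. -/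
theorem summable_of_forall_seminorm [UniformSpace S] [IsUniformAddGroup S] [ContinuousSMul ℝ S]
    [LocallyConvexSpace ℝ S] [CompleteSpace S] {ι : Type*} {f : ι → S}
    (h : ∀ p : Seminorm ℝ S, Continuous p → Summable fun i => p (f i)) : Summable f := by
  have hS := PolynormableSpace.withSeminorms ℝ S
  rw [summable_iff_vanishing]
  intro e he
  obtain ⟨s, r, hr, hsub⟩ := (hS.mem_nhds_iff 0 e).mp he
  have hp := Seminorm.continuous_finsetSup (s := s) fun i _ => hS.continuous_seminorm i
  obtain ⟨u, hu⟩ := summable_iff_vanishing.mp (h _ hp) (Metric.ball 0 r) (Metric.ball_mem_nhds 0 hr)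
  refine ⟨u, fun t ht => hsub ?_⟩
  rw [Seminorm.mem_ball, sub_zero]
  have h1 := hu t ht
  rw [mem_ball_zero_iff, Real.norm_eq_abs] at h1
  exact (Finset.le_sum_of_subadditive _ (map_zero _).le (map_add_le_add _) t f).trans_lt
    ((le_abs_self _).trans_lt h1)

theorem SeqDifferentiableAt.exists_tendsto_slope [TopologicalSpace S] [IsTopologicalAddGroup S]
    {u : ℝ → S} {t : ℝ} (hu : SeqDifferentiableAt u t) :
    ∃ u', Tendsto (slope u t) (𝓝[≠] t) (𝓝 u') := by
  obtain ⟨L, hL⟩ := hu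
  refine ⟨L 1, tendsto_of_seq_tendsto fun s hs => ?_⟩
  obtain ⟨hs1, hs2⟩ := tendsto_nhdsWithin_iff.mp hs
  obtain ⟨N, hN⟩ := eventually_atTop.mp hs2
  rw [← tendsto_add_atTop_iff_nat N]
  have h := hL (fun _ => 1) 1 (fun n => s (n + N) - t) tendsto_const_nhds
    (fun n => sub_ne_zero.mpr (hN _ (by lia)))
    (by simpa using ((tendsto_add_atTop_iff_nat N).mpr hs1).sub_const t)
  have h' := h.add_const (L 1)
  simpa [slope_def_module] using h'

/-- Product rule for the curve `s ↦ P s (u s)`, tested against a continuous functional. The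
operators `P s` along a sequence `s n → t` are equicontinuous by the Banach–Steinhaus theorem. -/
theorem hasDerivAt_apply_curve [UniformSpace S] [IsUniformAddGroup S] [ContinuousSMul ℝ S]
    [LocallyConvexSpace ℝ S] [BarrelledSpace ℝ S]
    {P : ℝ → S →L[ℝ] S} {u : ℝ → S} {t : ℝ} {u' q : S}
    (hP : ∀ φ, SeqDifferentiableAt (fun s => P s φ) t)
    (hu : Tendsto (slope u t) (𝓝[≠] t) (𝓝 u'))
    (hq : Tendsto (slope (fun s => P s (u t)) t) (𝓝[≠] t) (𝓝 q)) (ν : S →L[ℝ] ℂ) :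
    HasDerivAt (fun s => ν (P s (u s))) (ν (P t u' + q)) t := by
  have hS := PolynormableSpace.withSeminorms ℝ S
  rw [hasDerivAt_iff_tendsto_slope]
  refine tendsto_of_seq_tendsto fun s hs => ?_
  have hs0 : Tendsto (fun n => s n - t) atTop (𝓝 0) := by
    simpa using (tendsto_nhdsWithin_iff.mp hs).1.sub_const t
  have hev : ∀ᶠ n in atTop, s n - t ≠ 0 := by
    filter_upwards [(tendsto_nhdsWithin_iff.mp hs).2] with n hn using sub_ne_zero.mpr hn
  have hcont (φ : S) : Tendsto (fun n => P (s n) φ) atTop (𝓝 (P t φ)) := by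
    obtain ⟨w, hw⟩ := (hP φ).exists_tendsto_slope
    have h1 := (hs0.smul (hw.comp hs)).add_const (P t φ)
    rw [zero_smul, zero_add] at h1
    refine h1.congr' ?_
    filter_upwards [hev] with n hn
    simp [slope_def_module, smul_smul, hn]
  have hlim : Tendsto (fun n => P (s n) (slope u t (s n) - u')) atTop (𝓝 0) := by
    rw [hS.tendsto_nhds _ 0]
    intro i ε hε
    obtain ⟨p, hp, hle⟩ := exists_seminorm_forall_le (fun n => P (s n)) _
      (hS.continuous_seminorm i)
      fun φ => (((hS.continuous_seminorm i).tendsto _).comp (hcont φ)).bddAbove_range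
    have h0 : Tendsto (fun n => p (slope u t (s n) - u')) atTop (𝓝 0) := by
      have h1 := (hp.tendsto _).comp ((hu.comp hs).sub_const u')
      rwa [sub_self, map_zero] at h1
    filter_upwards [h0.eventually_lt_const hε] with n hn
    rw [sub_zero]
    exact (hle n _).trans_lt hn
  have h3 : Tendsto (fun n => P (s n) (slope u t (s n) - u') + P (s n) u'
      + slope (fun s => P s (u t)) t (s n)) atTop (𝓝 (0 + P t u' + q)) :=
    (hlim.add (hcont u')).add (hq.comp hs)
  rw [zero_add] at h3
  refine ((ν.continuous.tendsto _).comp h3).congr fun n => ?_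
  rw [Function.comp_apply, Function.comp_apply, slope_def_module, slope_def_module,
    slope_def_module, ← map_sub ν, ← map_smul ν]
  congr 1
  rw [map_sub, map_smul, map_sub]
  module

end LocallyConvex

namespace TestSpace

variable {E S : Type*} [NormedAddCommGroup E] [InnerProductSpace ℝ E]
  [AddCommGroup S] [Module ℝ S]

/-- The derivative of a test function, as a function of the direction, is a continuous linear map
with values in the space of test functions. -/
theorem exists_dirDeriv_eq [TopologicalSpace S] (Θ : TestSpace E S) (φ : S) :
    ∃ L : E →L[ℝ] S, HasSeqDerivAt (fun h => Θ.shift h φ) L 0 ∧ ∀ h, Θ.dirDeriv h φ = L h := by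
  obtain ⟨L, hL⟩ := Θ.shift_differentiable φ 0
  exact ⟨L, hL, fun h => (Θ.shift_deriv_zero φ L hL h).symm⟩

theorem IsLebesgueFeynman.apply_dirDeriv [TopologicalSpace S] {Θ : TestSpace E S} {ν : S →L[ℝ] ℂ}
    (hν : Θ.IsLebesgueFeynman ν) (h : E) (φ : S) : ν (Θ.dirDeriv h φ) = 0 := by
  obtain ⟨L, hL, hLh⟩ := Θ.exists_dirDeriv_eq φ
  have h1 := hL (fun _ => h) h (fun n => 1 / ((n : ℝ) + 1)) tendsto_const_nhds
    (fun n => Nat.one_div_pos_of_nat.ne') tendsto_one_div_add_atTop_nhds_zero_nat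
  have h2 := (ν.continuous.tendsto 0).comp h1
  have h3 : (ν ∘ fun n : ℕ => (1 / ((n : ℝ) + 1))⁻¹ •
      (Θ.shift (0 + (1 / ((n : ℝ) + 1)) • h) φ - Θ.shift 0 φ) - L h) = fun _ => - ν (L h) := by
    ext n
    simp [map_sub, map_smul, hν _ φ]
  rw [h3, map_zero] at h2
  rw [hLh]
  exact neg_eq_zero.mp (tendsto_nhds_unique tendsto_const_nhds h2)

/-- Joint continuity of `(h, φ) ↦ φ' h`. -/
theorem exists_seminorm_dirDeriv_le [TopologicalSpace S] [BarrelledSpace ℝ S]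
    (Θ : TestSpace E S) (p : Seminorm ℝ S) (hp : Continuous p) :
    ∃ q : Seminorm ℝ S, Continuous q ∧ ∀ h φ, p (Θ.dirDeriv h φ) ≤ ‖h‖ * q φ := by
  obtain ⟨q, hq, hle⟩ := exists_seminorm_forall_le
    (fun h : Metric.closedBall (0 : E) 1 => Θ.dirDeriv h) p hp fun φ => by
      obtain ⟨L, -, hL⟩ := Θ.exists_dirDeriv_eq φ
      obtain ⟨C, hC, hle⟩ := Seminorm.bound_of_continuous_normedSpace (p.comp L.toLinearMap)
        (hp.comp L.continuous)
      refine ⟨C, ?_⟩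
      rintro _ ⟨h, rfl⟩
      have h1 : ‖(h : E)‖ ≤ 1 := mem_closedBall_zero_iff.mp h.2
      calc p (Θ.dirDeriv h φ) = p.comp L.toLinearMap h := by rw [hL]; rfl
        _ ≤ C * ‖(h : E)‖ := hle h
        _ ≤ C := mul_le_of_le_one_right hC.le h1
  refine ⟨q, hq, fun h φ => ?_⟩
  obtain ⟨L, -, hL⟩ := Θ.exists_dirDeriv_eq φ
  rcases eq_or_ne h 0 with rfl | hne
  · simp [hL]
  have h0 : ‖h‖ ≠ 0 := norm_ne_zero_iff.mpr hne
  have h1 := hle ⟨‖h‖⁻¹ • h, by simp [norm_smul, h0]⟩ φ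
  calc p (Θ.dirDeriv h φ) = p (‖h‖ • Θ.dirDeriv (‖h‖⁻¹ • h) φ) := by
        rw [hL, hL, L.map_smul, smul_smul, mul_inv_cancel₀ h0, one_smul]
    _ = ‖h‖ * p (Θ.dirDeriv (‖h‖⁻¹ • h) φ) := by rw [map_smul_eq_mul, norm_norm]
    _ ≤ ‖h‖ * q φ := by gcongr

variable [UniformSpace S] [IsUniformAddGroup S] [ContinuousSMul ℝ S] [LocallyConvexSpace ℝ S]
  [CompleteSpace S] [BarrelledSpace ℝ S]

/-- The evaluation at a point, as a continuous linear functional. -/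
noncomputable def evalCLM (Θ : TestSpace E S) (x : E) : S →L[ℝ] ℂ where
  toFun φ := Θ.toFun φ x
  map_add' φ ψ := by simp
  map_smul' r φ := by simp
  cont := Θ.continuous_eval x

/-- The series `∑ φₙ' hₙ`, where `ψ k = ∑ φₙ hₙ`, converges in the space of test functions to the
divergence of the vector field `ψ k`. It is annihilated by the Lebesgue–Feynman measures, and
it is the sum of the partial derivatives of `ψ k` with respect to any Hilbert basis. -/
theorem IsVectorMultiplicator.exists_hasSum_fderiv [CompleteSpace E] {Θ : TestSpace E S} {k : E → E}
    (hk : Θ.IsVectorMultiplicator k) (ψ : S) :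
    ∃ D : S, (∀ ν : S →L[ℝ] ℂ, Θ.IsLebesgueFeynman ν → ν D = 0) ∧
      (∀ e : E, Differentiable ℝ fun y => (inner ℝ (k y) e : ℂ) * Θ.toFun ψ y) ∧
      ∀ (ι : Type _) (e : HilbertBasis ι ℝ E) (x : E),
        HasSum (fun j => fderiv ℝ (fun y => (inner ℝ (k y) (e j) : ℂ) * Θ.toFun ψ y) x (e j))
          (Θ.toFun D x) := by
  obtain ⟨h, φ, hs, hφ⟩ := hk ψ
  have hD : Summable fun n => Θ.dirDeriv (h n) (φ n) := by
    refine summable_of_forall_seminorm fun p hp => ?_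
    obtain ⟨q, hq, hle⟩ := Θ.exists_seminorm_dirDeriv_le p hp
    exact (hs q hq).of_nonneg_of_le (fun n => apply_nonneg _ _) fun n => hle _ _
  obtain ⟨D, hD⟩ := hD
  -- the components of the field `ψ k` are themselves test functions
  have hχ (e : E) : ∃ χ : S, HasSum (fun n => (inner ℝ (h n) e : ℝ) • φ n) χ ∧
      Θ.toFun χ = fun y => (inner ℝ (k y) e : ℂ) * Θ.toFun ψ y := by
    have hsum : Summable fun n => (inner ℝ (h n) e : ℝ) • φ n := by
      refine summable_of_forall_seminorm fun p hp => ?_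
      refine ((hs p hp).mul_left ‖e‖).of_nonneg_of_le (fun n => apply_nonneg _ _) fun n => ?_
      rw [map_smul_eq_mul]
      calc ‖inner ℝ (h n) e‖ * p (φ n) ≤ ‖h n‖ * ‖e‖ * p (φ n) :=
            mul_le_mul_of_nonneg_right (norm_inner_le_norm _ _) (apply_nonneg p _)
        _ = _ := by ring
    obtain ⟨χ, hχ⟩ := hsum
    refine ⟨χ, hχ, ?_⟩
    ext y
    have h1 := (Θ.evalCLM y).hasSum hχ
    refine h1.unique ((hφ y e).congr_fun ?_)
    intro n
    simp [evalCLM]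
  refine ⟨D, fun ν hν => ?_, fun e => ?_, fun ι e x => ?_⟩
  · refine (ν.hasSum hD).unique ?_
    simp_rw [hν.apply_dirDeriv]
    exact hasSum_zero
  · obtain ⟨χ, -, hχ⟩ := hχ e
    rw [← hχ]
    exact (Θ.smooth χ).differentiable (by simp)
  · let ℓ : ℕ → E →L[ℝ] ℂ := fun n => fderiv ℝ (Θ.toFun (φ n)) x
    have hDx : HasSum (fun n => ℓ n (h n)) (Θ.toFun D x) := by
      have h1 := (Θ.evalCLM x).hasSum hD
      exact h1.congr_fun fun n => (Θ.dirDeriv_apply (h n) (φ n) x).symm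
    have hpart (j : ι) : HasSum (fun n => (inner ℝ (h n) (e j) : ℂ) * ℓ n (e j))
        (fderiv ℝ (fun y => (inner ℝ (k y) (e j) : ℂ) * Θ.toFun ψ y) x (e j)) := by
      obtain ⟨χ, hχs, hχ⟩ := hχ (e j)
      rw [← hχ, ← Θ.dirDeriv_apply]
      have h1 := (Θ.evalCLM x).hasSum ((Θ.dirDeriv (e j)).hasSum hχs)
      refine h1.congr_fun fun n => ?_
      simp [evalCLM, Θ.dirDeriv_apply, ℓ]
    have hℓ : Summable fun n => ‖ℓ n‖ * ‖h n‖ := by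
      let p : Seminorm ℝ S := (normSeminorm ℝ ℂ).comp (Θ.evalCLM x).toLinearMap
      have hp : Continuous p := continuous_norm.comp (Θ.evalCLM x).continuous
      obtain ⟨q, hq, hle⟩ := Θ.exists_seminorm_dirDeriv_le p hp
      refine (hs q hq).of_nonneg_of_le (fun n => by positivity) fun n => ?_
      rw [mul_comm]
      gcongr
      refine ContinuousLinearMap.opNorm_le_bound _ (apply_nonneg _ _) fun v => ?_
      have h1 : ‖ℓ n v‖ = p (Θ.dirDeriv v (φ n)) := by
        simp only [ℓ, ← Θ.dirDeriv_apply]; rfl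
      rw [h1, mul_comm]
      exact hle v (φ n)
    -- real and imaginary parts are traces of real operators
    have key (R : ℂ →L[ℝ] ℝ) (hR : ∀ (r : ℝ) (z : ℂ), R (r * z) = r * R z) :
        HasSum (fun j => R (fderiv ℝ (fun y => (inner ℝ (k y) (e j) : ℂ) * Θ.toFun ψ y) x (e j)))
          (R (Θ.toFun D x)) := by
      let a : ℕ → E := fun n => (InnerProductSpace.toDual ℝ E).symm (R ∘L ℓ n)
      have ha (n : ℕ) (v : E) : inner ℝ (a n) v = R (ℓ n v) := by simp [a]
      have hah : Summable fun n => ‖a n‖ * ‖h n‖ := by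
        refine (hℓ.mul_left ‖R‖).of_nonneg_of_le (fun n => by positivity) fun n => ?_
        have : ‖a n‖ ≤ ‖R‖ * ‖ℓ n‖ := by
          simp only [a, LinearIsometryEquiv.norm_map]
          exact ContinuousLinearMap.opNorm_comp_le _ _
        rw [← mul_assoc]
        gcongr
      have h1 := hasSum_tsum_inner_mul_inner e hah
      rw [((R.hasSum hDx).congr_fun fun n => ha n (h n)).tsum_eq] at h1
      refine h1.congr_fun fun j => ?_
      rw [← ((R.hasSum (hpart j)).tsum_eq)]
      refine tsum_congr fun n => ?_
      rw [hR, ha, mul_comm]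
    rw [Complex.hasSum_iff]
    exact ⟨key Complex.reCLM (by simp), key Complex.imCLM (by simp)⟩

/-- Pointwise formula `div (ψ k) = ψ' k + ψ tr k'` at a point where `k` has a derivative of trace
class along lines. -/
theorem IsVectorMultiplicator.exists_divergence [CompleteSpace E] {Θ : TestSpace E S} {k : E → E}
    (hk : Θ.IsVectorMultiplicator k) (ψ : S) :
    ∃ D : S, (∀ ν : S →L[ℝ] ℂ, Θ.IsLebesgueFeynman ν → ν D = 0) ∧
      ∀ (ι : Type) (a b : ι → E) (C : E →L[ℝ] E) (x : E), IsNuclearExpansion a b C →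
        (∀ w, HasDerivAt (fun r : ℝ => k (x + r • w)) (C w) 0) →
        Θ.toFun D x = fderiv ℝ (Θ.toFun ψ) x (k x) +
          ((∑' i, inner ℝ (a i) (b i) : ℝ) : ℂ) * Θ.toFun ψ x := by
  obtain ⟨D, hD, hdiff, hsum⟩ := hk.exists_hasSum_fderiv ψ
  refine ⟨D, hD, fun ι a b C x hC hkd => ?_⟩
  obtain ⟨w, e, -⟩ := exists_hilbertBasis ℝ E
  refine (hsum w e x).unique ?_
  have hψ : Differentiable ℝ (Θ.toFun ψ) := (Θ.smooth ψ).differentiable (by simp)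
  have hline (v : E) : HasDerivAt (fun r : ℝ => x + r • v) v 0 := by
    simpa using ((hasDerivAt_id (0 : ℝ)).smul_const v).const_add x
  have hpart (j : w) : fderiv ℝ (fun y => (inner ℝ (k y) (e j) : ℂ) * Θ.toFun ψ y) x (e j)
      = inner ℝ (k x) (e j) • fderiv ℝ (Θ.toFun ψ) x (e j)
        + ((inner ℝ (C (e j)) (e j) : ℝ) : ℂ) * Θ.toFun ψ x := by
    have h1 : HasDerivAt (fun r : ℝ => (inner ℝ (k (x + r • e j)) (e j) : ℂ)
        * Θ.toFun ψ (x + r • e j))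
        (fderiv ℝ (fun y => (inner ℝ (k y) (e j) : ℂ) * Θ.toFun ψ y) x (e j)) 0 := by
      refine HasFDerivAt.comp_hasDerivAt_of_eq (0 : ℝ) ((hdiff (e j)) x).hasFDerivAt
        (hline (e j)) (by simp)
    have h2 : HasDerivAt (fun r : ℝ => Θ.toFun ψ (x + r • e j))
        (fderiv ℝ (Θ.toFun ψ) x (e j)) 0 :=
      HasFDerivAt.comp_hasDerivAt_of_eq (0 : ℝ) (hψ x).hasFDerivAt (hline (e j)) (by simp)
    have h3 : HasDerivAt (fun r : ℝ => ((inner ℝ (k (x + r • e j)) (e j) : ℝ) : ℂ))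
        ((inner ℝ (C (e j)) (e j) : ℝ) : ℂ) 0 := by
      have := ((hkd (e j)).inner ℝ (hasDerivAt_const (0 : ℝ) (e j))).ofReal_comp
      simpa using this
    rw [h1.unique (h3.mul h2)]
    simp [add_comm]
  simp_rw [hpart]
  refine HasSum.add ?_ (HasSum.mul_right _ ?_)
  · have h1 := (fderiv ℝ (Θ.toFun ψ) x).hasSum (e.hasSum_repr (k x))
    refine h1.congr_fun fun j => ?_
    rw [map_smul, e.repr_apply_apply, real_inner_comm]
  · have h1 := hasSum_tsum_inner_mul_inner e hC.summable
    refine Complex.hasSum_ofReal.mpr (h1.congr_fun fun j => ?_)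
    have h2 := (innerSL ℝ (e j)).hasSum (hC.hasSum (e j))
    rw [real_inner_comm, ← innerSL_apply_apply ℝ (e j), ← h2.tsum_eq]
    refine tsum_congr fun i => ?_
    simp [real_inner_comm]

end TestSpace

/-! ### Calculus of derivatives along sequences -/

section SequentialDerivative

variable {X Y Z : Type*} [NormedAddCommGroup X] [NormedSpace ℝ X]

/-- Chain rule along a differentiable curve: this is what distinguishes differentiability along
convergent sequences of directions from Gateaux differentiability. -/
theorem HasSeqDerivAt.comp_hasDerivAt [NormedAddCommGroup Y] [NormedSpace ℝ Y] {f : X → Y}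
    {f' : X →L[ℝ] Y} {γ : ℝ → X} {v : X} {r : ℝ} (hf : HasSeqDerivAt f f' (γ r))
    (hγ : HasDerivAt γ v r) : HasDerivAt (fun s => f (γ s)) (f' v) r := by
  rw [hasDerivAt_iff_tendsto_slope] at hγ ⊢
  refine tendsto_of_seq_tendsto fun s hs => ?_
  obtain ⟨hs1, hs2⟩ := tendsto_nhdsWithin_iff.mp hs
  obtain ⟨N, hN⟩ := eventually_atTop.mp hs2
  rw [← tendsto_add_atTop_iff_nat N]
  have hs' := (tendsto_add_atTop_iff_nat N).mpr hs
  have hne (n : ℕ) : s (n + N) - r ≠ 0 := sub_ne_zero.mpr (hN _ (by lia))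
  have h := hf (fun n => slope γ r (s (n + N))) v (fun n => s (n + N) - r) (hγ.comp hs') hne
    (by simpa using ((tendsto_add_atTop_iff_nat N).mpr hs1).sub_const r)
  have h' := h.add ((f'.continuous.tendsto v).comp (hγ.comp hs'))
  rw [zero_add] at h'
  refine h'.congr fun n => ?_
  simp [slope_def_module, smul_smul, hne n]

theorem HasSeqDerivAt.clm_comp [AddCommGroup Y] [Module ℝ Y] [TopologicalSpace Y]
    [AddCommGroup Z] [Module ℝ Z] [TopologicalSpace Z] {f : X → Y} {f' : X →L[ℝ] Y} {x : X}
    (hf : HasSeqDerivAt f f' x) (L : Y →L[ℝ] Z) :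
    HasSeqDerivAt (fun x => L (f x)) (L ∘L f') x := by
  intro h h₀ t hh ht ht0
  have h1 := (L.continuous.tendsto 0).comp (hf h h₀ t hh ht ht0)
  rw [map_zero] at h1
  refine h1.congr fun n => ?_
  simp [map_sub, map_smul]

theorem HasSeqDerivAt.comp_affine [AddCommGroup Y] [Module ℝ Y] [TopologicalSpace Y]
    [NormedAddCommGroup Z] [NormedSpace ℝ Z] {f : X → Y} {f' : X →L[ℝ] Y} {x : X} (A : Z →L[ℝ] X)
    {z : Z} (hf : HasSeqDerivAt f f' (x + A z)) :
    HasSeqDerivAt (fun z => f (x + A z)) (f' ∘L A) z := by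
  intro h h₀ t hh ht ht0
  refine (hf (fun n => A (h n)) (A h₀) t ((A.continuous.tendsto _).comp hh) ht ht0).congr
    fun n => ?_
  simp [add_assoc]

/-- In finite dimension, differentiability along sequences is Fréchet differentiability. -/
theorem HasSeqDerivAt.hasFDerivAt [FiniteDimensional ℝ X] [NormedAddCommGroup Y] [NormedSpace ℝ Y]
    {f : X → Y} {f' : X →L[ℝ] Y} {x : X} (hf : HasSeqDerivAt f f' x) : HasFDerivAt f f' x := by
  have : ProperSpace X := FiniteDimensional.proper ℝ X
  rw [hasFDerivAt_iff_tendsto]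
  by_contra hcon
  rw [Metric.tendsto_nhds] at hcon
  push Not at hcon
  obtain ⟨ε, hε, hfr⟩ := hcon
  -- points `y n → x` violating the estimate, with converging directions
  obtain ⟨y, hy, hyε⟩ := exists_seq_forall_of_frequently hfr
  have hyne (n : ℕ) : y n - x ≠ 0 := by
    intro h0
    have := hyε n
    simp [sub_eq_zero.mp h0] at this
    linarith
  have hmem (n : ℕ) : ‖y n - x‖⁻¹ • (y n - x) ∈ Metric.sphere (0 : X) 1 := by
    simp [norm_smul, hyne n]
  obtain ⟨v, -, φ, hφ, hv⟩ := (isCompact_sphere (0 : X) 1).tendsto_subseq hmem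
  have hn (n : ℕ) : ‖y n - x‖ ≠ 0 := norm_ne_zero_iff.mpr (hyne n)
  have h0 : Tendsto (fun n => ‖y (φ n) - x‖) atTop (𝓝 0) := by
    have := ((hy.comp hφ.tendsto_atTop).sub_const x).norm
    simpa using this
  have h1 := (hf (fun n => ‖y (φ n) - x‖⁻¹ • (y (φ n) - x)) v (fun n => ‖y (φ n) - x‖) hv
    (fun n => hn _) h0).norm
  rw [norm_zero] at h1
  obtain ⟨n, hlt⟩ := (h1.eventually_lt_const hε).exists
  have h2 := hyε (φ n)
  rw [dist_zero_right, Real.norm_eq_abs, abs_of_nonneg (by positivity)] at h2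
  rw [smul_smul, mul_inv_cancel₀ (hn _), one_smul, add_sub_cancel, map_smul, ← smul_sub, norm_smul,
    norm_inv, norm_norm] at hlt
  linarith

/-- Evaluation at a vector is continuous for the topology of compact convergence. -/
noncomputable def evalCompactConvergence [NormedAddCommGroup Y] [NormedSpace ℝ Y] (v : X) :
    (X →L_c[ℝ] Y) →L[ℝ] Y where
  toFun A := A v
  map_add' _ _ := rfl
  map_smul' _ _ := rfl
  cont := continuous_eval_const v

theorem HasSeqDerivAt.eval [NormedAddCommGroup Y] [NormedSpace ℝ Y]
    {f' : X → (X →L_c[ℝ] Y)} {f'' : X →L_c[ℝ] (X →L_c[ℝ] Y)} {x : X}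
    (hx : HasSeqDerivAt f' f'' x) (u : X) :
    HasSeqDerivAt (fun y => f' y u) ((evalCompactConvergence u).comp f'' : X →L[ℝ] Y) x :=
  HasSeqDerivAt.clm_comp hx (evalCompactConvergence u)

/-- The second derivative is symmetric: on the plane spanned by two directions the map is twice
Fréchet differentiable. -/
theorem HasSeqDerivAt.second_derivative_symmetric [NormedAddCommGroup Y] [NormedSpace ℝ Y]
    {f : X → Y} {f' : X → (X →L_c[ℝ] Y)} {f'' : X →L_c[ℝ] (X →L_c[ℝ] Y)} {x : X}
    (hf : ∀ᶠ y in 𝓝 x, HasSeqDerivAt f (f' y) y) (hx : HasSeqDerivAt f' f'' x) (v w : X) :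
    f'' v w = f'' w v := by
  let A : ℝ × ℝ →L[ℝ] X := (ContinuousLinearMap.fst ℝ ℝ ℝ).smulRight v +
    (ContinuousLinearMap.snd ℝ ℝ ℝ).smulRight w
  let D (u : X) : ℝ × ℝ → Y := fun z => f' (x + A z) u
  have hA : Tendsto (fun z => x + A z) (𝓝 0) (𝓝 x) := by
    have h : Continuous fun z => x + A z := by fun_prop
    simpa using h.tendsto 0
  have hD (u : X) :
      HasFDerivAt (D u) (((evalCompactConvergence u).comp f'' : X →L[ℝ] Y).comp A) 0 := by
    refine HasSeqDerivAt.hasFDerivAt (HasSeqDerivAt.comp_affine (f := fun y => f' y u) A ?_)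
    rw [map_zero, add_zero]
    exact hx.eval u
  let g' : ℝ × ℝ → ℝ × ℝ →L[ℝ] Y := fun z =>
    ContinuousLinearMap.smulRightL ℝ (ℝ × ℝ) Y (ContinuousLinearMap.fst ℝ ℝ ℝ) (D v z) +
    ContinuousLinearMap.smulRightL ℝ (ℝ × ℝ) Y (ContinuousLinearMap.snd ℝ ℝ ℝ) (D w z)
  have hg : ∀ᶠ z in 𝓝 0, HasFDerivAt (fun z => f (x + A z)) (g' z) z := by
    filter_upwards [hA.eventually hf] with z hz
    have h1 : g' z = ContinuousLinearMap.comp (f' (x + A z) : X →L[ℝ] Y) A := by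
      refine ContinuousLinearMap.ext fun r => ?_
      have h2 := ((f' (x + A z) : X →L[ℝ] Y).map_add (r.1 • v) (r.2 • w)).trans
        (congrArg₂ (· + ·) ((f' (x + A z) : X →L[ℝ] Y).map_smul r.1 v)
          ((f' (x + A z) : X →L[ℝ] Y).map_smul r.2 w))
      exact h2.symm
    rw [h1]
    exact HasSeqDerivAt.hasFDerivAt (HasSeqDerivAt.comp_affine A hz)
  have hg' := ((ContinuousLinearMap.smulRightL ℝ (ℝ × ℝ) Y
      (ContinuousLinearMap.fst ℝ ℝ ℝ)).hasFDerivAt.comp (0 : ℝ × ℝ) (hD v)).add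
    ((ContinuousLinearMap.smulRightL ℝ (ℝ × ℝ) Y
      (ContinuousLinearMap.snd ℝ ℝ ℝ)).hasFDerivAt.comp (0 : ℝ × ℝ) (hD w))
  have h := second_derivative_symmetric_of_eventually (f' := g') hg hg' (1, 0) (0, 1)
  have e1 : A (1, 0) = v := by simp [A]
  have e2 : A (0, 1) = w := by simp [A]
  simp only [add_apply, ContinuousLinearMap.comp_apply, e1, e2,
    ContinuousLinearMap.smulRightL_apply_apply, ContinuousLinearMap.smulRight_apply,
    ContinuousLinearMap.coe_fst', ContinuousLinearMap.coe_snd', one_smul, zero_smul, zero_add,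
    add_zero] at h
  exact h

end SequentialDerivative

/-! ### Families of transformations -/

section Flow

variable {E : Type*} [NormedAddCommGroup E] [NormedSpace ℝ E] {F Finv : ℝ → E → E} {I : Set ℝ}

theorem fderiv_mul_fderiv_of_leftInverse {f g : E → E} (hf : Differentiable ℝ f)
    (hg : Differentiable ℝ g) (hgf : ∀ x, g (f x) = x) (x : E) :
    fderiv ℝ g (f x) * fderiv ℝ f x = 1 := by
  have h := (hg (f x)).hasFDerivAt.comp x (hf x).hasFDerivAt
  have h1 : g ∘ f = id := funext hgf
  rw [h1] at h
  exact h.unique (hasFDerivAt_id x)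

/-- The partial derivatives of a map that is differentiable along sequences. -/
theorem HasSeqDerivAt.hasDerivAt_fst {Φ' : ℝ × E →L[ℝ] E} {t : ℝ} {x : E}
    (h : HasSeqDerivAt (fun p : ℝ × E => F p.1 p.2) Φ' (t, x)) :
    HasDerivAt (fun s => F s x) (Φ' (1, 0)) t :=
  HasSeqDerivAt.comp_hasDerivAt (γ := fun s => (s, x)) h
    ((hasDerivAt_id t).prodMk (hasDerivAt_const t x))

theorem HasSeqDerivAt.fderiv_snd_apply {Φ' : ℝ × E →L[ℝ] E} {t : ℝ} {x : E}
    (h : HasSeqDerivAt (fun p : ℝ × E => F p.1 p.2) Φ' (t, x)) (hF : DifferentiableAt ℝ (F t) x)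
    (v : E) : fderiv ℝ (F t) x v = Φ' (0, v) := by
  have hline : HasDerivAt (fun r : ℝ => x + r • v) v 0 := by
    simpa using ((hasDerivAt_id (0 : ℝ)).smul_const v).const_add x
  have h1 : HasDerivAt (fun r : ℝ => F t (x + r • v)) (fderiv ℝ (F t) x v) 0 :=
    HasFDerivAt.comp_hasDerivAt_of_eq (0 : ℝ) hF.hasFDerivAt hline (by simp)
  refine h1.unique (HasSeqDerivAt.comp_hasDerivAt (γ := fun r : ℝ => (t, x + r • v))
    (by simpa using h) ((hasDerivAt_const (0 : ℝ) t).prodMk hline))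

/-- The curve `s ↦ F⁻¹(s, x)` moves with velocity `-(F⁻¹)₂'(t, x) k(x)`, where `k` is the velocity
field of the family `F`. -/
theorem hasDerivAt_inverse_flow (hI : IsOpen I)
    (hF : TwiceContDiffOn (fun p : ℝ × E => F p.1 p.2) (I ×ˢ Set.univ))
    (hFinv : TwiceContDiffOn (fun p : ℝ × E => Finv p.1 p.2) (I ×ˢ Set.univ))
    (hF_smooth : ∀ t ∈ I, Differentiable ℝ (F t))
    (hFinv_smooth : ∀ t ∈ I, Differentiable ℝ (Finv t))
    (hF_left : ∀ t ∈ I, ∀ x, Finv t (F t x) = x) (hF_right : ∀ t ∈ I, ∀ x, F t (Finv t x) = x)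
    {t : ℝ} (ht : t ∈ I) (x : E) :
    HasDerivAt (fun s => Finv s x)
      (-(fderiv ℝ (Finv t) x (deriv (fun s => F s (Finv t x)) t))) t := by
  obtain ⟨Φ', -, hΦ, -⟩ := hF
  obtain ⟨Ψ', -, hΨ, -⟩ := hFinv
  have h1 := hΦ (t, Finv t x) ⟨ht, trivial⟩
  have h2 := (hΨ (t, x) ⟨ht, trivial⟩).hasDerivAt_fst
  set w := Ψ' (t, x) (1, 0)
  -- differentiate `F (s, Finv (s, x)) = x`
  have h3 : HasDerivAt (fun s => F s (Finv s x)) (Φ' (t, Finv t x) (1, w)) t :=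
    HasSeqDerivAt.comp_hasDerivAt (γ := fun s => (s, Finv s x)) h1
      ((hasDerivAt_id t).prodMk h2)
  have h4 : HasDerivAt (fun s => F s (Finv s x)) 0 t := by
    refine (hasDerivAt_const t x).congr_of_eventuallyEq ?_
    filter_upwards [hI.mem_nhds ht] with s hs using hF_right s hs x
  have h5 : deriv (fun s => F s (Finv t x)) t + fderiv ℝ (F t) (Finv t x) w = 0 := by
    have hadd := (Φ' (t, Finv t x) : ℝ × E →L[ℝ] E).map_add (1, 0) (0, w)
    rw [Prod.mk_add_mk, add_zero, zero_add] at hadd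
    rw [h1.hasDerivAt_fst.deriv, h1.fderiv_snd_apply (hF_smooth t ht _)]
    exact hadd.symm.trans (h3.unique h4)
  have h6 : fderiv ℝ (Finv t) x (fderiv ℝ (F t) (Finv t x) w) = w := by
    have := fderiv_mul_fderiv_of_leftInverse (hF_smooth t ht) (hFinv_smooth t ht) (hF_left t ht)
      (Finv t x)
    rw [hF_right t ht] at this
    exact congrArg (fun A : E →L[ℝ] E => A w) this
  rw [eq_neg_of_add_eq_zero_left h5, map_neg, neg_neg, h6]
  exact h2

/-- The derivative of the velocity field `k` is `k' = (∂ₜ F₂') (F⁻¹)₂'`, because the mixed second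
derivatives of `F` coincide. -/
theorem hasDerivAt_velocity_line (hI : IsOpen I)
    (hF : TwiceContDiffOn (fun p : ℝ × E => F p.1 p.2) (I ×ˢ Set.univ))
    (hF_smooth : ∀ t ∈ I, Differentiable ℝ (F t))
    (hFinv_smooth : ∀ t ∈ I, Differentiable ℝ (Finv t))
    {t : ℝ} (ht : t ∈ I) (x : E) {B : E → E}
    (hB : ∀ v, HasDerivAt (fun s => fderiv ℝ (F s) (Finv t x) v) (B v) t) (w : E) :
    HasDerivAt (fun r : ℝ => deriv (fun s => F s (Finv t (x + r • w))) t)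
      (B (fderiv ℝ (Finv t) x w)) 0 := by
  obtain ⟨Φ', Φ'', hΦ, hΦ', -⟩ := hF
  set y := Finv t x with hy
  set v := fderiv ℝ (Finv t) x w with hv
  have h2 := hΦ' (t, y) ⟨ht, trivial⟩
  have hBv : B v = Φ'' (t, y) (1, 0) (0, v) := by
    have h3 : HasDerivAt (fun s => Φ' (s, y) (0, v)) (Φ'' (t, y) (1, 0) (0, v)) t :=
      (h2.eval (0, v)).comp_hasDerivAt (γ := fun s => (s, y))
        ((hasDerivAt_id t).prodMk (hasDerivAt_const t y))
    refine ((hB v).congr_of_eventuallyEq ?_).unique h3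
    filter_upwards [hI.mem_nhds ht] with s hs
    exact ((hΦ (s, y) ⟨hs, trivial⟩).fderiv_snd_apply (hF_smooth s hs y) v).symm
  have hsymm : Φ'' (t, y) (1, 0) (0, v) = Φ'' (t, y) (0, v) (1, 0) := by
    refine HasSeqDerivAt.second_derivative_symmetric (f := fun p : ℝ × E => F p.1 p.2) ?_ h2 _ _
    filter_upwards [(hI.prod isOpen_univ).mem_nhds (show (t, y) ∈ I ×ˢ Set.univ from ⟨ht, trivial⟩)]
      with p hp using hΦ p hp
  have hk (z : E) : deriv (fun s => F s (Finv t z)) t = Φ' (t, Finv t z) (1, 0) :=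
    (hΦ (t, Finv t z) ⟨ht, trivial⟩).hasDerivAt_fst.deriv
  simp only [hk]
  rw [hBv, hsymm]
  have hline : HasDerivAt (fun r : ℝ => x + r • w) w 0 := by
    simpa using ((hasDerivAt_id (0 : ℝ)).smul_const w).const_add x
  have h4 : HasDerivAt (fun r : ℝ => Finv t (x + r • w)) v 0 :=
    HasFDerivAt.comp_hasDerivAt_of_eq (0 : ℝ) (hFinv_smooth t ht x).hasFDerivAt hline (by simp)
  have h5 : HasSeqDerivAt (fun p => Φ' p (1, 0))
      ((evalCompactConvergence (1, 0)).comp (Φ'' (t, y)) : ℝ × E →L[ℝ] E)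
      (t, Finv t (x + (0 : ℝ) • w)) := by
    rw [zero_smul, add_zero]
    exact h2.eval (1, 0)
  exact h5.comp_hasDerivAt (γ := fun r : ℝ => (t, Finv t (x + r • w)))
    ((hasDerivAt_const (0 : ℝ) t).prodMk h4)

end Flow

theorem TestSpace.hasDerivAt_of_tendsto_slope {E S : Type*} [NormedAddCommGroup E]
    [InnerProductSpace ℝ E] [AddCommGroup S] [Module ℝ S] [TopologicalSpace S]
    (Θ : TestSpace E S) {u : ℝ → S} {u' : S} {t : ℝ} (hu : Tendsto (slope u t) (𝓝[≠] t) (𝓝 u'))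
    (x : E) : HasDerivAt (fun s => Θ.toFun (u s) x) (Θ.toFun u' x) t := by
  rw [hasDerivAt_iff_tendsto_slope]
  refine (((Θ.continuous_eval x).tendsto u').comp hu).congr fun s => ?_
  simp [slope_def_module]

theorem SeqDifferentiableAt.congr_of_eventuallyEq {S : Type*} [AddCommGroup S] [Module ℝ S]
    [TopologicalSpace S] {u v : ℝ → S} {t : ℝ} (hu : SeqDifferentiableAt u t) (h : v =ᶠ[𝓝 t] u) :
    SeqDifferentiableAt v t := by
  obtain ⟨L, hL⟩ := hu
  refine ⟨L, fun a a₀ r ha hr hr0 => (hL a a₀ r ha hr hr0).congr' ?_⟩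
  have h1 : Tendsto (fun n => t + r n • a n) atTop (𝓝 t) := by
    simpa using (hr0.smul ha).const_add t
  filter_upwards [h1.eventually h] with n hn
  rw [hn, h.self_of_nhds]

/-- Jacobi's formula for the reciprocal of the determinant, with the trace taken of `B * G`, where
`B` is the derivative and `G` the inverse of `A t`. For `A t = F₂'(t, ·)` the operator `B * G` is the
derivative of the velocity field. -/
theorem exists_isNuclearExpansion_hasDerivAt_inv_fredholmDet {E : Type*} [NormedAddCommGroup E]
    [InnerProductSpace ℝ E] [CompleteSpace E] {A : ℝ → E →L[ℝ] E} {t : ℝ} {B G : E →L[ℝ] E}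
    (hA : ∀ᶠ s in 𝓝 t, IsTraceClass (A s - 1)) (hGA : G * A t = 1) (hAG : A t * G = 1)
    (hB : Tendsto (fun s => traceNorm ((s - t)⁻¹ • (A s - A t) - B)) (𝓝[≠] t) (𝓝 0)) :
    ∃ a b : ℕ ⊕ ℕ ⊕ ℕ → E, IsNuclearExpansion a b (B * G) ∧
      HasDerivAt (fun s => (fredholmDet (A s))⁻¹)
        (-((fredholmDet (A t))⁻¹ * ∑' i, inner ℝ (a i) (b i))) t := by
  obtain ⟨a, b, hab⟩ := exists_isNuclearExpansion_of_tendsto hA hB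
  refine ⟨fun i => G.adjoint (a i), b, hab.comp_right G, ?_⟩
  have htr : ∑' i, inner ℝ (G.adjoint (a i)) (b i) = ∑' i, inner ℝ (a i) (G (b i)) :=
    tsum_congr fun i => G.adjoint_inner_left (b i) (a i)
  have hne := hA.self_of_nhds.fredholmDet_ne_zero hGA
  refine ((hasDerivAt_fredholmDet hA hGA hAG hab hB).inv hne).congr_deriv ?_
  rw [htr]
  field_simp

theorem theorem4
    {E : Type*} [NormedAddCommGroup E] [InnerProductSpace ℝ E] [CompleteSpace E]
    [TopologicalSpace.SeparableSpace E]
    {S : Type*} [AddCommGroup S] [Module ℝ S] [UniformSpace S] [IsUniformAddGroup S]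
    [ContinuousSMul ℝ S] [LocallyConvexSpace ℝ S] [CompleteSpace S] [BarrelledSpace ℝ S]
    (Θ : TestSpace E S)
    -- the family of transformations, defined for times in the interval `(α, β)`
    (α β : ℝ) (hα : α < 0) (hβ : 0 < β)
    (F Finv : ℝ → E → E)
    (hF : TwiceContDiffOn (fun p : ℝ × E => F p.1 p.2) (Set.Ioo α β ×ˢ Set.univ))
    (hF_zero : ∀ x, F 0 x = x)
    (hF_smooth : ∀ t ∈ Set.Ioo α β, ContDiff ℝ ∞ (F t))
    (hF_left : ∀ t ∈ Set.Ioo α β, ∀ x, Finv t (F t x) = x)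
    (hF_right : ∀ t ∈ Set.Ioo α β, ∀ x, F t (Finv t x) = x)
    (hFinv_smooth : ∀ t ∈ Set.Ioo α β, ContDiff ℝ ∞ (Finv t))
    (hFinv : TwiceContDiffOn (fun p : ℝ × E => Finv p.1 p.2) (Set.Ioo α β ×ˢ Set.univ))
    -- `F₂'(t, x) - 1` is of trace class and depends differentiably on `t` in the trace norm
    (hF_trace : ∀ t ∈ Set.Ioo α β, ∀ x, IsTraceClass (fderiv ℝ (F t) x - 1))
    (hF_trace_deriv : ∀ t ∈ Set.Ioo α β, ∀ x,
      TraceDifferentiableAt (fun s => fderiv ℝ (F s) x) t)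
    -- the transformations act on test functions, differentiably in `t`
    (h_comp : ∀ t ∈ Set.Ioo α β, Θ.IsComposable (Finv t))
    (h_comp_deriv : ∀ φ : S,
      Θ.IsDifferentiableCurve (Set.Ioo α β) fun t x => Θ.toFun φ (Finv t x))
    -- the velocity field `k`, `k (F (t, x)) = F₁' (t, x)`, multiplies test functions
    (h_field : ∀ t ∈ Set.Ioo α β,
      Θ.IsVectorMultiplicator fun x => deriv (fun s => F s (Finv t x)) t)
    -- the determinant is a multiplicator, and one can divide by it, differentiably in `t`
    (h_det : ∀ t ∈ Set.Ioo α β, Θ.IsMultiplicator fun x => fredholmDet (fderiv ℝ (F t) x))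
    (h_det_inv_deriv : ∀ φ : S,
      Θ.IsDifferentiableCurve (Set.Ioo α β) fun t x =>
        (((fredholmDet (fderiv ℝ (F t) x))⁻¹ : ℝ) : ℂ) * Θ.toFun φ x)
    -- the Lebesgue-Feynman measure
    (ν : S →L[ℝ] ℂ) (hν : Θ.IsLebesgueFeynman ν) :
    ∀ φ : S, ∀ t ∈ Set.Ioo α β,
      Θ.integral ν (fun x => Θ.toFun φ (Finv t x)) =
        Θ.integral ν (fun x => Θ.toFun φ x * (fredholmDet (fderiv ℝ (F t) x) : ℂ)) := by
  have hI : IsOpen (Set.Ioo α β) := isOpen_Ioo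
  have hFd (t) (ht : t ∈ Set.Ioo α β) : Differentiable ℝ (F t) :=
    (hF_smooth t ht).differentiable (by simp)
  have hFinvd (t) (ht : t ∈ Set.Ioo α β) : Differentiable ℝ (Finv t) :=
    (hFinv_smooth t ht).differentiable (by simp)
  have hGA (t) (ht : t ∈ Set.Ioo α β) (x : E) :
      fderiv ℝ (Finv t) (F t x) * fderiv ℝ (F t) x = 1 :=
    fderiv_mul_fderiv_of_leftInverse (hFd t ht) (hFinvd t ht) (hF_left t ht) x
  have hdet (t) (ht : t ∈ Set.Ioo α β) (x : E) : fredholmDet (fderiv ℝ (F t) x) ≠ 0 :=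
    (hF_trace t ht x).fredholmDet_ne_zero (hGA t ht x)
  have h0 : (0 : ℝ) ∈ Set.Ioo α β := ⟨hα, hβ⟩
  -- the operators of composition with `Finv t`, extended by zero outside of the interval
  have hPex (t : ℝ) : ∃ P : S →L[ℝ] S, t ∈ Set.Ioo α β →
      ∀ (φ : S) (x : E), Θ.toFun (P φ) x = Θ.toFun φ (Finv t x) := by
    by_cases ht : t ∈ Set.Ioo α β
    · obtain ⟨P, hP⟩ := h_comp t ht
      exact ⟨P, fun _ => hP⟩
    · exact ⟨0, fun h => absurd h ht⟩
  choose P hP using hPex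
  have hPdiff (φ : S) (t : ℝ) (ht : t ∈ Set.Ioo α β) : SeqDifferentiableAt (fun s => P s φ) t := by
    obtain ⟨v, hv⟩ := h_comp_deriv φ
    refine (hv t ht).2.congr_of_eventuallyEq ?_
    filter_upwards [hI.mem_nhds ht] with s hs
    refine Θ.injective (funext fun x => ?_)
    rw [hP s hs, (hv s hs).1]
  -- the pull-back of `φ / det` has an integral which does not depend on time
  have main (φ : S) : ∃ u : ℝ → S,
      (∀ t ∈ Set.Ioo α β, ∀ x, Θ.toFun (u t) x =
        (((fredholmDet (fderiv ℝ (F t) x))⁻¹ : ℝ) : ℂ) * Θ.toFun φ x) ∧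
      ∀ t ∈ Set.Ioo α β, HasDerivAt (fun s => ν (P s (u s))) 0 t := by
    obtain ⟨u, hu⟩ := h_det_inv_deriv φ
    have hu1 (t) (ht : t ∈ Set.Ioo α β) (x : E) : Θ.toFun (u t) x =
        (((fredholmDet (fderiv ℝ (F t) x))⁻¹ : ℝ) : ℂ) * Θ.toFun φ x := congrFun (hu t ht).1 x
    refine ⟨u, hu1, fun t ht => ?_⟩
    obtain ⟨u', hu'⟩ := (hu t ht).2.exists_tendsto_slope
    obtain ⟨q, hq⟩ := (hPdiff (u t) t ht).exists_tendsto_slope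
    obtain ⟨D, hD, hDx⟩ := (h_field t ht).exists_divergence (P t (u t))
    suffices hsum : P t u' + q = -D by
      have h := hasDerivAt_apply_curve (fun φ => hPdiff φ t ht) hu' hq ν
      rwa [hsum, map_neg, hD ν hν, neg_zero] at h
    refine Θ.injective (funext fun x => ?_)
    set y := Finv t x with hy
    set G := fderiv ℝ (Finv t) x with hG
    have hGA' : G * fderiv ℝ (F t) y = 1 := by
      have := hGA t ht y
      rwa [hy, hF_right t ht] at this
    have hAG' : fderiv ℝ (F t) y * G = 1 :=
      fderiv_mul_fderiv_of_leftInverse (hFinvd t ht) (hFd t ht) (hF_right t ht) x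
    obtain ⟨B, hB⟩ := hF_trace_deriv t ht y
    have hev : ∀ᶠ s in 𝓝 t, IsTraceClass (fderiv ℝ (F s) y - 1) := by
      filter_upwards [hI.mem_nhds ht] with s hs using hF_trace s hs y
    obtain ⟨a, b, hab, hdet'⟩ :=
      exists_isNuclearExpansion_hasDerivAt_inv_fredholmDet hev hGA' hAG' hB
    have hdiv := hDx _ a b _ x hab fun w =>
      hasDerivAt_velocity_line hI hF hFd hFinvd ht x (hasDerivAt_apply_of_tendsto_traceNorm hB) w
    -- the derivative of `u` at the point `y`
    have hu'y : Θ.toFun u' y =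
        -(((∑' i, inner ℝ (a i) (b i) : ℝ) : ℂ) * Θ.toFun (P t (u t)) x) := by
      have h1 : HasDerivAt (fun s => Θ.toFun (u s) y)
          (((-((fredholmDet (fderiv ℝ (F t) y))⁻¹ * ∑' i, inner ℝ (a i) (b i)) : ℝ) : ℂ)
            * Θ.toFun φ y) t := by
        refine (hdet'.ofReal_comp.mul_const (Θ.toFun φ y)).congr_of_eventuallyEq ?_
        filter_upwards [hI.mem_nhds ht] with s hs using hu1 s hs y
      rw [(Θ.hasDerivAt_of_tendsto_slope hu' y).unique h1, hP t ht, hu1 t ht]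
      push_cast
      ring
    -- the transport equation for the pull-back of the fixed function `u t`
    have hqx : Θ.toFun q x = -(fderiv ℝ (Θ.toFun (P t (u t))) x
        (deriv (fun s => F s (Finv t x)) t)) := by
      have hd : DifferentiableAt ℝ (Θ.toFun (u t)) y :=
        (Θ.smooth (u t)).differentiable (by simp) y
      have h1 : HasDerivAt (fun s => Θ.toFun (P s (u t)) x)
          (fderiv ℝ (Θ.toFun (u t)) y (-(G (deriv (fun s => F s (Finv t x)) t)))) t := by
        refine (hd.hasFDerivAt.comp_hasDerivAt t (hasDerivAt_inverse_flow hI hF hFinv hFd hFinvd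
          hF_left hF_right ht x)).congr_of_eventuallyEq ?_
        filter_upwards [hI.mem_nhds ht] with s hs using hP s hs (u t) x
      have h2 : Θ.toFun (P t (u t)) = Θ.toFun (u t) ∘ Finv t := funext (hP t ht (u t))
      rw [(Θ.hasDerivAt_of_tendsto_slope hq x).unique h1, h2,
        fderiv_comp x hd (hFinvd t ht x), map_neg]
      rfl
    rw [map_add, map_neg, Pi.add_apply, Pi.neg_apply, hdiv, hP t ht, hu'y, hqx]
    ring
  intro φ t ht
  -- apply this to `φ det F₂'(t, ·)` instead of `φ`, between the times `0` and `t`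
  obtain ⟨M, hM⟩ := h_det t ht
  obtain ⟨u, hu, hderiv⟩ := main (M φ)
  have hconst : ν (P t (u t)) = ν (P 0 (u 0)) := by
    refine isOpen_Ioo.is_const_of_deriv_eq_zero isPreconnected_Ioo
      (fun s hs => (hderiv s hs).differentiableAt.differentiableWithinAt)
      (fun s hs => (hderiv s hs).deriv) ht h0
  have hut : u t = φ := by
    refine Θ.injective (funext fun x => ?_)
    have hne : ((fredholmDet (fderiv ℝ (F t) x) : ℝ) : ℂ) ≠ 0 :=
      Complex.ofReal_ne_zero.mpr (hdet t ht x)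
    rw [hu t ht, hM, Complex.ofReal_inv, inv_mul_cancel_left₀ hne]
  have hF0 : F 0 = id := funext hF_zero
  have hPu0 : P 0 (u 0) = M φ := by
    refine Θ.injective (funext fun x => ?_)
    have hinv : Finv 0 x = x := by
      have := hF_left 0 h0 x
      rwa [hF_zero] at this
    have hid : fderiv ℝ (id : E → E) x = 1 := fderiv_id
    rw [hP 0 h0, hinv, hu 0 h0, hF0, hid, fredholmDet_one]
    simp
  rw [hut, hPu0] at hconst
  have e1 : (fun x => Θ.toFun φ (Finv t x)) = Θ.toFun (P t φ) :=
    funext fun x => (hP t ht φ x).symm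
  have e2 : (fun x => Θ.toFun φ x * (fredholmDet (fderiv ℝ (F t) x) : ℂ)) = Θ.toFun (M φ) :=
    funext fun x => by rw [hM, mul_comm]
  rw [e1, e2, Θ.integral_toFun, Θ.integral_toFun, hconst]
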